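/- Let $X=\{0,1\}^{*}$ be the set of finite binary sequences and $|s|$ the length of $s\in X$. A computer is a partial recursive function $C\colon X\to X$ whose domain $\operatorname{Dom}C$ is prefix-free. Fix any optimal computer $U$, that is, a computer such that for every computer $C$ there is a constant $c_C$ such that for every $p\in\operatorname{Dom}C$ there is a $q$ with $U(q)=C(p)$ and $|q|\le|p|+c_C$. Put $H(s)=\min\{|p| : U(p)=s\}$. For an infinite binary sequence $\alpha$ let $\alpha_n$ be its prefix of length $n$. For $D\ge 0$, $\alpha$ is called weakly Chaitin $D$-random if there is $c\in\mathbb{R}$ with $Dn-c\le H(\alpha_n)$ for all $n\in\mathbb{N}$, and $D$-compressible if $H(\alpha_n)\le Dn+o(n)$. A real number $x$ is identified with the infinite binary sequence of the digits after the point in the base-two expansion with infinitely many zeros of $x-\lfloor x\rfloor$. A real number $x$ is computable if a base-two expansion of $x-\lfloor x\rfloor$ can be generated by an algorithm. Let $f\colon(0,1)\to\mathbb{R}$ be given by $$f(D)=\Omega^D=\sum_{p\in\operatorname{Dom}U}2^{-|p|/D},$$ and for $p\in\operatorname{Dom}U$ let $f_p\colon(0,1)\to\mathbb{R}$, $f_p(D)=2^{-|p|/D}$.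 Then: (a) The series defining $f$ converges on $(0,1)$, $f$ is of class $C^\infty$, and for each integer $k\ge 1$ and each $D\in(0,1)$, $$f^{(k)}(D)=\sum_{p\in\operatorname{Dom}U}f_p^{(k)}(D),$$ the series being (absolutely) convergent. (b) For each integer $k\ge 1$ and each computable real number $D\in(0,1)$, the real number $f^{(k)}(D)$ is weakly Chaitin $D$-random and $D$-compressible. -/

import Mathlib

open Set Filter Asymptotics
open scoped ContDiff

/-- A computer: a partial recursive function from finite binary sequences to finite binary
sequences whose domain is prefix-free. -/
structure IsComputer (C : List Bool →. List Bool) : Prop where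
  partrec : Partrec C
  prefixFree : ∀ p ∈ C.Dom, ∀ q ∈ C.Dom, p <+: q → p = q

/-- An optimal computer: it simulates every computer with an additive constant overhead in the
length of programs. -/
structure IsOptimalComputer (U : List Bool →. List Bool) : Prop where
  isComputer : IsComputer U
  simulates : ∀ C : List Bool →. List Bool, IsComputer C → ∃ sim : ℕ,
    ∀ p s, s ∈ C p → ∃ q, s ∈ U q ∧ q.length ≤ p.length + sim

/-- The program-size complexity of `s` with respect to `C`: the least length of a program `p` with
`C p = s`, and `⊤` if there is none. -/
noncomputable def complexity (C : List Bool →. List Bool) (s : List Bool) : ℕ∞ :=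
  ⨅ p ∈ {p : List Bool | s ∈ C p}, (p.length : ℕ∞)

/-- The same complexity as an extended real number. -/
noncomputable def ecomplexity (C : List Bool →. List Bool) (s : List Bool) : EReal :=
  ((complexity C s : ENNReal) : EReal)

/-- The prefix of length `n` of an infinite binary sequence. -/
def bitPrefix (α : ℕ → Bool) (n : ℕ) : List Bool := (List.range n).map α

/-- The base-two expansion of the fractional part of `x`, with infinitely many zeros: the entry
with index `i` is the digit of weight `2 ^ (-(i + 1))`. -/
noncomputable def binaryExpansion (x : ℝ) (i : ℕ) : Bool :=
  decide (⌊Int.fract x * 2 ^ (i + 1)⌋ % 2 = 1)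

/-- A real number is computable if a base-two expansion of its fractional part can be generated by
an algorithm. -/
def IsComputableReal (x : ℝ) : Prop :=
  ∃ b : ℕ → Bool, Computable b ∧
    HasSum (fun i : ℕ => if b i then ((2 : ℝ) ^ (i + 1))⁻¹ else 0) (Int.fract x)

/-- Weak Chaitin `D`-randomness of an infinite binary sequence, with complexity relative to `U`. -/
def IsWeaklyChaitinRandom (U : List Bool →. List Bool) (D : ℝ) (α : ℕ → Bool) : Prop :=
  ∃ c : ℝ, ∀ n : ℕ, ((D * n - c : ℝ) : EReal) ≤ ecomplexity U (bitPrefix α n)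

/-- `D`-compressibility of an infinite binary sequence, with complexity relative to `U`:
`H(α_n) ≤ D n + o(n)`. -/
def IsCompressible (U : List Bool →. List Bool) (D : ℝ) (α : ℕ → Bool) : Prop :=
  ∃ g : ℕ → ℝ, g =o[atTop] (fun n : ℕ => (n : ℝ)) ∧
    ∀ n : ℕ, ecomplexity U (bitPrefix α n) ≤ ((D * n + g n : ℝ) : EReal)

/-- The function `D ↦ 2 ^ (-|p| / D)`. -/
noncomputable def haltingTerm (p : List Bool) (D : ℝ) : ℝ := (2 : ℝ) ^ (-(p.length : ℝ) / D)

/-- The generalized halting probability: the sum of `2 ^ (-|p| / D)` over the domain of `U`. -/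
noncomputable def haltingProb (U : List Bool →. List Bool) (D : ℝ) : ℝ :=
  ∑' p : U.Dom, haltingTerm p D

/-! The `k`-th derivative of `x ↦ 2 ^ (-l / x)` is `x ^ (-k) * P (u) * exp (-u)` with `u = l * log 2
/ x` and `P` monic of degree `k`. Two estimates follow: it is at most `C * 2 ^ (-(1 - δ) * l / x)`
for every `δ > 0`, and for `k ≥ 1` it is at least `2 ^ (-l / x)` once `l` is large. With Kraft's
inequality the upper bound gives a summable majorant on compact subintervals of `(0, 1)`, hence
termwise differentiation. For computable `D` the terms are also uniformly computable, through
iterated difference quotients. Part (b) then needs only these facts about `S = ∑ a |p|`.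

Randomness (`IsOptimalComputer.isWeaklyChaitinRandom`): the first `n` bits of `S` allow a search for
a stage of the enumeration of `Dom U` at which the partial sum is within `O(2 ^ (-n))` of `S`. A
program that has not yet halted then satisfies `2 ^ (-|q| / D) ≤ O(2 ^ (-n))`, so `|q| ≥ D * n -
O(1)`. A string not output so far thus has complexity at least `D * n - O(1)`, yet it is computed
from the `n` bits.

Compressibility (`IsOptimalComputer.isCompressible`): `m` bits of `Ω = ∑ 2 ^ (-|p|)` determine a
stage after which only programs of length at least `m` remain. For `1 ≤ θ < 1 / D` the rest of `S`
is then `O(2 ^ (-θ * m))`, so about `θ * m` bits of `S` follow up to a bounded correction. Letting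
`θ` tend to `1 / D` gives `D * n + o(n)`. -/

section HaltingDeriv

/-! ### Closed form and estimates for the derivatives of one term. -/

open Polynomial

/-- The polynomials `P k` for which the `k`-th derivative of `x ↦ exp (-L / x)` is
`x ^ (-k) * P k (L / x) * exp (-L / x)`. -/
noncomputable def haltingPoly : ℕ → ℝ[X]
  | 0 => 1
  | k + 1 => X * haltingPoly k - X * derivative (haltingPoly k) - C (k : ℝ) * haltingPoly k

/-- The `k`-th derivative of `x ↦ 2 ^ (-l / x)` at `x > 0`. -/
noncomputable def haltingDeriv (k l : ℕ) (x : ℝ) : ℝ :=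
  x⁻¹ ^ k * (haltingPoly k).eval (l * Real.log 2 / x) * Real.exp (-(l * Real.log 2 / x))

theorem haltingPoly_monic_natDegree (k : ℕ) :
    (haltingPoly k).Monic ∧ (haltingPoly k).natDegree = k := by
  induction k with
  | zero => simp [haltingPoly]
  | succ k ih =>
    obtain ⟨hm, hd⟩ := ih
    have h1 : (X * haltingPoly k).Monic := monic_X.mul hm
    have h2 : (X * haltingPoly k).natDegree = k + 1 := by
      rw [monic_X.natDegree_mul hm, hd, natDegree_X, add_comm]
    have hlt : (X * derivative (haltingPoly k) + C (k : ℝ) * haltingPoly k).degree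
        < (X * haltingPoly k).degree := by
      rw [degree_eq_natDegree h1.ne_zero, h2]
      refine lt_of_le_of_lt (degree_le_of_natDegree_le (n := k) ?_) (by exact_mod_cast k.lt_succ_self)
      refine natDegree_add_le_of_degree_le ?_ ((natDegree_C_mul_le _ _).trans hd.le)
      rcases k with _ | k
      · simp [haltingPoly]
      · refine natDegree_mul_le.trans ?_
        have := natDegree_derivative_le (haltingPoly (k + 1))
        rw [hd] at this
        rw [natDegree_X]
        omega
    have he : haltingPoly (k + 1) = X * haltingPoly k
        - (X * derivative (haltingPoly k) + C (k : ℝ) * haltingPoly k) := by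
      rw [haltingPoly]; ring
    rw [he]
    refine ⟨h1.sub_of_left hlt, ?_⟩
    rw [natDegree_sub_eq_left_of_natDegree_lt, h2]
    by_cases h0 : X * derivative (haltingPoly k) + C (k : ℝ) * haltingPoly k = 0
    · rw [h0, h2]; simp
    · exact natDegree_lt_natDegree h0 hlt

theorem hasDerivAt_haltingDeriv (k l : ℕ) {x : ℝ} (hx : 0 < x) :
    HasDerivAt (haltingDeriv k l) (haltingDeriv (k + 1) l x) x := by
  set L := (l : ℝ) * Real.log 2
  have hu : HasDerivAt (fun y : ℝ => L / y) (-(L / x ^ 2)) x := by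
    refine ((hasDerivAt_inv hx.ne').const_mul L).congr_deriv ?_
    field_simp
  have h1 : HasDerivAt (fun y : ℝ => y⁻¹ ^ k) (-(k : ℝ) * x⁻¹ ^ (k + 1)) x := by
    refine ((hasDerivAt_inv hx.ne').fun_pow k).congr_deriv ?_
    rcases k with _ | k
    · simp
    · simp only [Nat.add_sub_cancel]; ring
  have h2 : HasDerivAt (fun y : ℝ => (haltingPoly k).eval (L / y))
      ((derivative (haltingPoly k)).eval (L / x) * (-(L / x ^ 2))) x :=
    ((haltingPoly k).hasDerivAt (L / x)).comp x hu
  have h3 : HasDerivAt (fun y : ℝ => Real.exp (-(L / y)))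
      (Real.exp (-(L / x)) * -(-(L / x ^ 2))) x := hu.fun_neg.exp
  refine ((h1.fun_mul h2).fun_mul h3).congr_deriv ?_
  change _ = x⁻¹ ^ (k + 1) * (haltingPoly (k + 1)).eval (L / x) * Real.exp (-(L / x))
  simp only [haltingPoly, eval_sub, eval_mul, eval_X, eval_C]
  ring

theorem haltingTerm_eq_haltingDeriv (p : List Bool) (x : ℝ) :
    haltingTerm p x = haltingDeriv 0 p.length x := by
  simp only [haltingTerm, haltingDeriv, haltingPoly, Real.rpow_def_of_pos two_pos]
  simp only [pow_zero, eval_one, one_mul]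
  congr 1
  ring

theorem haltingDeriv_zero_eq_rpow (l : ℕ) (x : ℝ) :
    haltingDeriv 0 l x = (2 : ℝ) ^ (-(l : ℝ) / x) := by
  have := haltingTerm_eq_haltingDeriv (List.replicate l true) x
  rw [List.length_replicate] at this
  rw [← this, haltingTerm, List.length_replicate]

theorem iteratedDerivWithin_haltingTerm (k : ℕ) (p : List Bool) {x : ℝ} (hx : x ∈ Ioo (0 : ℝ) 1) :
    iteratedDerivWithin k (haltingTerm p) (Ioo 0 1) x = haltingDeriv k p.length x := by
  induction k generalizing x with
  | zero => rw [iteratedDerivWithin_zero, haltingTerm_eq_haltingDeriv]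
  | succ k ih =>
    rw [iteratedDerivWithin_succ, derivWithin_congr (fun y hy => ih hy) (ih hx)]
    exact (hasDerivAt_haltingDeriv k _ hx.1).hasDerivWithinAt.derivWithin
      (isOpen_Ioo.uniqueDiffWithinAt hx)

/-- On monomials this is one term of the exponential series, `(δ * u) ^ n / n! ≤ exp (δ * u)`. -/
theorem exists_abs_eval_mul_exp_le (P : ℝ[X]) {δ : ℝ} (hδ : 0 < δ) :
    ∃ C : ℝ, 0 ≤ C ∧ ∀ u : ℝ, 0 ≤ u → |P.eval u| ≤ C * Real.exp (δ * u) := by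
  induction P using Polynomial.induction_on' with
  | add p q hp hq =>
    obtain ⟨C, hC, h⟩ := hp
    obtain ⟨D, hD, h'⟩ := hq
    refine ⟨C + D, add_nonneg hC hD, fun u hu => ?_⟩
    rw [eval_add, add_mul]
    exact (abs_add_le _ _).trans (add_le_add (h u hu) (h' u hu))
  | monomial n a =>
    refine ⟨|a| * (n.factorial / δ ^ n), by positivity, fun u hu => ?_⟩
    have := Real.pow_div_factorial_le_exp (δ * u) (by positivity) n
    rw [eval_monomial, abs_mul, abs_of_nonneg (pow_nonneg hu n), mul_assoc]
    refine mul_le_mul_of_nonneg_left ?_ (abs_nonneg a)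
    rw [div_le_iff₀ (by positivity), mul_pow] at this
    rw [div_mul_eq_mul_div, le_div_iff₀ (by positivity)]
    linarith

/-- The polynomial factor costs only an arbitrarily small share `δ` of the exponential decay; `C` is
uniform in `l` and in `x ≥ a`. -/
theorem exists_abs_haltingDeriv_le (k : ℕ) {a δ : ℝ} (ha : 0 < a) (hδ : 0 < δ) :
    ∃ C : ℝ, 0 ≤ C ∧ ∀ (l : ℕ) (x : ℝ), a ≤ x →
      |haltingDeriv k l x| ≤ C * (2 : ℝ) ^ (-((1 - δ) * l / x)) := by
  obtain ⟨C, hC, h⟩ := exists_abs_eval_mul_exp_le (haltingPoly k) hδ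
  refine ⟨a⁻¹ ^ k * C, by positivity, fun l x hx => ?_⟩
  have hx0 : 0 < x := ha.trans_le hx
  have hlog : 0 < Real.log 2 := Real.log_pos one_lt_two
  have h1 := h (l * Real.log 2 / x) (by positivity)
  rw [haltingDeriv, abs_mul, abs_mul, Real.abs_exp, abs_of_nonneg (by positivity : 0 ≤ x⁻¹ ^ k),
    Real.rpow_def_of_pos two_pos]
  have h2 : Real.exp (Real.log 2 * (-((1 - δ) * l / x)))
      = Real.exp (δ * (l * Real.log 2 / x)) * Real.exp (-(l * Real.log 2 / x)) := by
    rw [← Real.exp_add]; congr 1; ring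
  rw [h2, ← mul_assoc]
  refine mul_le_mul_of_nonneg_right ?_ (Real.exp_pos _).le
  rw [mul_assoc]
  gcongr

theorem exists_abs_haltingDeriv_le_const (k : ℕ) {a : ℝ} (ha : 0 < a) :
    ∃ C : ℝ, 0 ≤ C ∧ ∀ (l : ℕ) (x : ℝ), a ≤ x → |haltingDeriv k l x| ≤ C := by
  obtain ⟨C, hC, h⟩ := exists_abs_haltingDeriv_le k ha one_pos
  exact ⟨C, hC, fun l x hx => by simpa using h l x hx⟩

theorem abs_haltingDeriv_sub_le {k : ℕ} {a C : ℝ} (ha : 0 < a)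
    (hC : ∀ (l : ℕ) (x : ℝ), a ≤ x → |haltingDeriv (k + 1) l x| ≤ C) (l : ℕ) {x y : ℝ}
    (hx : a ≤ x) (hy : a ≤ y) : |haltingDeriv k l y - haltingDeriv k l x| ≤ C * |y - x| :=
  (convex_Ici a).norm_image_sub_le_of_norm_hasDerivWithin_le
    (fun _ hz => (hasDerivAt_haltingDeriv k l (ha.trans_le hz)).hasDerivWithinAt)
    (hC l) hx hy

/-- Mean value theorem twice. This is the error of the difference quotient that computes the next
derivative. -/
theorem abs_haltingDeriv_add_sub_sub_le {k : ℕ} {a C : ℝ} (ha : 0 < a)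
    (hC : ∀ (l : ℕ) (x : ℝ), a ≤ x → |haltingDeriv (k + 2) l x| ≤ C) (l : ℕ) {x h : ℝ}
    (hx : a ≤ x) (hh : 0 < h) :
    |haltingDeriv k l (x + h) - haltingDeriv k l x - h * haltingDeriv (k + 1) l x|
      ≤ C * h * h := by
  obtain ⟨ξ, hξ, he⟩ := exists_hasDerivAt_eq_slope (haltingDeriv k l) (haltingDeriv (k + 1) l)
    (lt_add_of_pos_right x hh)
    (fun z hz => (hasDerivAt_haltingDeriv k l
      (ha.trans_le (hx.trans hz.1))).continuousAt.continuousWithinAt)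
    (fun z hz => hasDerivAt_haltingDeriv k l (ha.trans_le (hx.trans hz.1.le)))
  rw [add_sub_cancel_left, eq_div_iff hh.ne'] at he
  rw [← he, mul_comm, ← mul_sub, abs_mul, abs_of_pos hh, mul_comm]
  have hC0 : 0 ≤ C := (abs_nonneg _).trans (hC l x hx)
  refine mul_le_mul_of_nonneg_right ((abs_haltingDeriv_sub_le ha hC l hx
    (hx.trans hξ.1.le)).trans ?_) hh.le
  rw [abs_of_pos (by linarith [hξ.1])]
  exact mul_le_mul_of_nonneg_left (by linarith [hξ.2]) hC0

/-- The polynomial is monic of positive degree, so its value eventually exceeds `x ^ k` and cancels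
the factor `x ^ (-k)`. For small `l` the derivative may be negative. -/
theorem exists_rpow_le_haltingDeriv {k : ℕ} (hk : 1 ≤ k) {x : ℝ} (hx : 0 < x) :
    ∃ l₀ : ℕ, ∀ l, l₀ ≤ l → (2 : ℝ) ^ (-(l : ℝ) / x) ≤ haltingDeriv k l x := by
  obtain ⟨hm, hd⟩ := haltingPoly_monic_natDegree k
  have h1 : Tendsto (fun u => (haltingPoly k).eval u) atTop atTop := by
    refine tendsto_atTop_of_leadingCoeff_nonneg _ ?_ ?_
    · rw [degree_eq_natDegree hm.ne_zero, hd]; exact_mod_cast hk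
    · rw [hm.leadingCoeff]; exact zero_le_one
  have hlog : 0 < Real.log 2 := Real.log_pos one_lt_two
  have h2 : Tendsto (fun l : ℕ => (l : ℝ) * (Real.log 2 / x)) atTop atTop :=
    tendsto_natCast_atTop_atTop.atTop_mul_const (by positivity)
  obtain ⟨l₀, h⟩ := ((h1.comp h2).eventually_ge_atTop (x ^ k)).exists_forall_of_atTop
  refine ⟨l₀, fun l hl => ?_⟩
  have h3 := h l hl
  rw [← haltingDeriv_zero_eq_rpow]
  simp only [haltingDeriv, haltingPoly, pow_zero, eval_one, one_mul]
  simp only [Function.comp] at h3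
  rw [mul_div_assoc]
  refine le_mul_of_one_le_left (Real.exp_pos _).le ?_
  rw [inv_pow, inv_mul_eq_div, one_le_div (by positivity)]
  exact h3

end HaltingDeriv

/-! ### Kraft's inequality for prefix-free domains. -/

section Kraft

theorem uniquelyDecodable_of_prefixFree {S : Set (List Bool)} (h0 : [] ∉ S)
    (h : ∀ p ∈ S, ∀ q ∈ S, p <+: q → p = q) : InformationTheory.UniquelyDecodable S := by
  intro L₁
  induction L₁ with
  | nil =>
    intro L₂ _ h2 he
    rcases L₂ with _ | ⟨q, L⟩
    · rfl
    · have : q = [] := by simp at he; exact he.1.symm ▸ rfl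
      exact absurd (this ▸ h2 q List.mem_cons_self) h0
  | cons p L₁ ih =>
    intro L₂ h1 h2 he
    rcases L₂ with _ | ⟨q, L₂⟩
    · have : p = [] := by simp at he; exact he.1.symm ▸ rfl
      exact absurd (this ▸ h1 p List.mem_cons_self) h0
    · have hp := h1 p List.mem_cons_self
      have hq := h2 q List.mem_cons_self
      rw [List.flatten_cons, List.flatten_cons] at he
      have hpq : p = q := by
        rcases List.prefix_or_prefix_of_prefix (List.prefix_append p L₁.flatten)
          (he ▸ List.prefix_append q L₂.flatten) with h' | h'
        · exact h p hp q hq h'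
        · exact (h q hq p hp h').symm
      subst hpq
      rw [ih L₂ (fun w hw => h1 w (List.mem_cons_of_mem _ hw))
        (fun w hw => h2 w (List.mem_cons_of_mem _ hw)) (List.append_cancel_left he)]

theorem sum_half_pow_length_le_one {S : Finset (List Bool)}
    (h : ∀ p ∈ S, ∀ q ∈ S, p <+: q → p = q) : ∑ p ∈ S, (1 / 2 : ℝ) ^ p.length ≤ 1 := by
  -- The empty word prevents unique decodability, but a prefix-free set containing it is a
  -- singleton.
  by_cases h0 : [] ∈ S
  · have : S = {[]} := Finset.eq_singleton_iff_unique_mem.2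
      ⟨h0, fun q hq => (h [] h0 q hq List.nil_prefix).symm⟩
    simp [this]
  · have := InformationTheory.kraft_mcmillan_inequality
      (uniquelyDecodable_of_prefixFree (S := (S : Set (List Bool))) (by simpa using h0)
        (by simpa using h))
    simpa using this

variable {U : List Bool →. List Bool}

theorem IsComputer.sum_half_pow_length_le_one (hU : IsComputer U) (u : Finset U.Dom) :
    ∑ p ∈ u, (1 / 2 : ℝ) ^ (p : List Bool).length ≤ 1 := by
  have := _root_.sum_half_pow_length_le_one (S := u.map (Function.Embedding.subtype _)) (by
    simp only [Finset.mem_map, Function.Embedding.subtype_apply]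
    rintro p ⟨p', -, rfl⟩ q ⟨q', -, rfl⟩
    exact hU.prefixFree _ p'.2 _ q'.2)
  simpa using this

theorem IsComputer.summable_half_pow_length (hU : IsComputer U) :
    Summable (fun p : U.Dom => (1 / 2 : ℝ) ^ (p : List Bool).length) :=
  summable_of_sum_le (fun _ => by positivity) hU.sum_half_pow_length_le_one

theorem IsComputer.tsum_half_pow_length_le_one (hU : IsComputer U) :
    ∑' p : U.Dom, (1 / 2 : ℝ) ^ (p : List Bool).length ≤ 1 :=
  Real.tsum_le_of_sum_le (fun _ => by positivity) hU.sum_half_pow_length_le_one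

end Kraft

/-! ### Termwise differentiation of the series. -/

section HaltingProbDeriv

theorem exists_abs_haltingDeriv_le_half_pow (k : ℕ) {a b : ℝ} (ha : 0 < a) (hb : b < 1) :
    ∃ C : ℝ, 0 ≤ C ∧ ∀ (l : ℕ) (x : ℝ), a ≤ x → x ≤ b →
      |haltingDeriv k l x| ≤ C * (1 / 2 : ℝ) ^ l := by
  -- With `δ = 1 - b` the exponent is `-(b * l / x)`, at most `-l` because `x ≤ b`.
  obtain ⟨C, hC, h⟩ := exists_abs_haltingDeriv_le k ha (sub_pos.2 hb)
  refine ⟨C, hC, fun l x hax hxb => (h l x hax).trans (mul_le_mul_of_nonneg_left ?_ hC)⟩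
  have hx : 0 < x := ha.trans_le hax
  rw [one_div, inv_pow, ← Real.rpow_natCast, ← Real.rpow_neg two_pos.le]
  refine Real.rpow_le_rpow_of_exponent_le one_le_two (neg_le_neg ?_)
  rw [sub_sub_cancel, le_div_iff₀ hx, mul_comm]
  gcongr

variable {U : List Bool →. List Bool}

theorem IsComputer.summable_haltingDeriv (hU : IsComputer U) (k : ℕ) {x : ℝ}
    (hx : x ∈ Ioo (0 : ℝ) 1) :
    Summable (fun p : U.Dom => haltingDeriv k (p : List Bool).length x) := by
  obtain ⟨C, -, h⟩ := exists_abs_haltingDeriv_le_half_pow k hx.1 hx.2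
  exact Summable.of_norm_bounded (hU.summable_half_pow_length.mul_left C)
    (fun p => h _ x le_rfl le_rfl)

theorem IsComputer.hasDerivAt_tsum_haltingDeriv (hU : IsComputer U) (k : ℕ) {x : ℝ}
    (hx : x ∈ Ioo (0 : ℝ) 1) :
    HasDerivAt (fun y => ∑' p : U.Dom, haltingDeriv k (p : List Bool).length y)
      (∑' p : U.Dom, haltingDeriv (k + 1) (p : List Bool).length x) x := by
  have ha : 0 < x / 2 := half_pos hx.1
  obtain ⟨C, -, h⟩ := exists_abs_haltingDeriv_le_half_pow (k + 1) ha
    (show (x + 1) / 2 < 1 by linarith [hx.2])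
  have hmem : x ∈ Ioo (x / 2) ((x + 1) / 2) := ⟨by linarith [hx.1], by linarith [hx.2]⟩
  exact hasDerivAt_tsum_of_isPreconnected (hU.summable_half_pow_length.mul_left C) isOpen_Ioo
    isPreconnected_Ioo (fun p y hy => hasDerivAt_haltingDeriv k _ (ha.trans hy.1))
    (fun p y hy => h _ y hy.1.le hy.2.le) hmem (hU.summable_haltingDeriv k hx) hmem

theorem IsComputer.iteratedDerivWithin_haltingProb (hU : IsComputer U) (k : ℕ) {x : ℝ}
    (hx : x ∈ Ioo (0 : ℝ) 1) :
    iteratedDerivWithin k (haltingProb U) (Ioo 0 1) x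
      = ∑' p : U.Dom, haltingDeriv k (p : List Bool).length x := by
  induction k generalizing x with
  | zero =>
    rw [iteratedDerivWithin_zero, haltingProb]
    exact tsum_congr fun p => haltingTerm_eq_haltingDeriv _ _
  | succ k ih =>
    rw [iteratedDerivWithin_succ, derivWithin_congr (fun y hy => ih hy) (ih hx)]
    exact (hU.hasDerivAt_tsum_haltingDeriv k hx).hasDerivWithinAt.derivWithin
      (isOpen_Ioo.uniqueDiffWithinAt hx)

theorem IsComputer.contDiffOn_haltingProb (hU : IsComputer U) :
    ContDiffOn ℝ ∞ (haltingProb U) (Ioo 0 1) := by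
  refine contDiffOn_of_differentiableOn_deriv (n := ⊤) fun k _ => ?_
  refine DifferentiableOn.congr (fun x hx => ?_)
    (fun x hx => hU.iteratedDerivWithin_haltingProb k hx)
  exact (hU.hasDerivAt_tsum_haltingDeriv k hx).differentiableAt.differentiableWithinAt

end HaltingProbDeriv

/-! ### Uniform computability of the terms. -/

section Approximation

theorem Primrec.nat_pow : Primrec₂ ((· ^ ·) : ℕ → ℕ → ℕ) :=
  Primrec₂.unpaired'.1 Nat.Primrec.pow

theorem Primrec.two_pow : Primrec fun n : ℕ => 2 ^ n :=
  Primrec.nat_pow.comp (Primrec.const 2) Primrec.id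

/-- The integer part of `2 ^ n * 2 ^ (-l / x)` for `x = z / 2 ^ e`, computed by bounded search. -/
def floorHaltingTerm (l z e n : ℕ) : ℕ :=
  Nat.findGreatest (fun w => w ^ z * 2 ^ (l * 2 ^ e) ≤ 2 ^ (n * z)) (2 ^ n)

theorem primrec_floorHaltingTerm :
    Primrec fun t : ℕ × ℕ × ℕ × ℕ => floorHaltingTerm t.1 t.2.1 t.2.2.1 t.2.2.2 := by
  have hz : Primrec fun t : (ℕ × ℕ × ℕ × ℕ) × ℕ => t.1.2.1 := Primrec.fst.comp <|
    Primrec.snd.comp Primrec.fst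
  have he : Primrec fun t : (ℕ × ℕ × ℕ × ℕ) × ℕ => t.1.2.2.1 := Primrec.fst.comp <|
    Primrec.snd.comp <| Primrec.snd.comp Primrec.fst
  have hn : Primrec fun t : (ℕ × ℕ × ℕ × ℕ) × ℕ => t.1.2.2.2 := Primrec.snd.comp <|
    Primrec.snd.comp <| Primrec.snd.comp Primrec.fst
  refine Primrec.nat_findGreatest
    (Primrec.two_pow.comp (Primrec.snd.comp (Primrec.snd.comp Primrec.snd))) ?_
  exact Primrec.nat_le.comp
    (Primrec.nat_mul.comp (Primrec.nat_pow.comp Primrec.snd hz)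
      (Primrec.two_pow.comp (Primrec.nat_mul.comp (Primrec.fst.comp Primrec.fst)
        (Primrec.two_pow.comp he))))
    (Primrec.two_pow.comp (Primrec.nat_mul.comp hn hz))

theorem abs_floorHaltingTerm_sub_le (l : ℕ) {z : ℕ} (hz : z ≠ 0) (e n : ℕ) :
    |(floorHaltingTerm l z e n : ℝ) - 2 ^ n * haltingDeriv 0 l (z / 2 ^ e)| ≤ 1 := by
  set y : ℝ := 2 ^ n * haltingDeriv 0 l (z / 2 ^ e) with hy
  have hz' : (z : ℝ) ≠ 0 := Nat.cast_ne_zero.2 hz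
  have hy0 : 0 ≤ y := by rw [hy, haltingDeriv_zero_eq_rpow]; positivity
  have hyn : y ≤ 2 ^ n := by
    rw [hy, haltingDeriv_zero_eq_rpow]
    refine mul_le_of_le_one_right (by positivity) (Real.rpow_le_one_of_one_le_of_nonpos one_le_two ?_)
    rw [neg_div]
    exact neg_nonpos.2 (by positivity)
  have hyz : y ^ z * 2 ^ (l * 2 ^ e) = 2 ^ (n * z) := by
    rw [hy, haltingDeriv_zero_eq_rpow, mul_pow, ← pow_mul, ← Real.rpow_mul_natCast two_pos.le,
      mul_assoc, ← Real.rpow_natCast 2 (l * 2 ^ e), ← Real.rpow_add two_pos]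
    have : -(l : ℝ) / (z / 2 ^ e) * z + ((l * 2 ^ e : ℕ) : ℝ) = 0 := by
      push_cast
      field_simp
      ring
    rw [this, Real.rpow_zero, mul_one]
  -- Raising to the power `z` clears the denominator of the exponent `-l * 2 ^ e / z`, so the
  -- comparison involves integers only.
  have hP (w : ℕ) : w ^ z * 2 ^ (l * 2 ^ e) ≤ 2 ^ (n * z) ↔ (w : ℝ) ≤ y := by
    rw [← pow_le_pow_iff_left₀ (Nat.cast_nonneg w) hy0 hz,
      ← mul_le_mul_iff_left₀ (show (0 : ℝ) < 2 ^ (l * 2 ^ e) by positivity), hyz]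
    exact_mod_cast Iff.rfl
  have hf : floorHaltingTerm l z e n = ⌊y⌋₊ := by
    rw [floorHaltingTerm, Nat.findGreatest_eq_iff]
    refine ⟨?_, fun _ => (hP _).2 (Nat.floor_le hy0), fun w hw _ h => ?_⟩
    · exact_mod_cast (Nat.floor_le hy0).trans hyn
    · exact absurd ((hP w).1 h) (not_le.2 ((Nat.floor_lt hy0).1 hw))
  rw [hf, abs_le]
  exact ⟨by linarith [Nat.lt_floor_add_one y], by linarith [Nat.floor_le hy0]⟩

/-- The next derivative is approximated by the difference quotient with step `2 ^ (-n)`, from values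
of precision `2 * n`: dividing by the step costs `n` bits, and the quadratic error becomes a
constant. The pair `P`, `Q` encodes a signed integer. -/
theorem exists_primrec_approx_haltingDeriv (k : ℕ) {a : ℝ} (ha : 0 < a) :
    ∃ P Q : ℕ × ℕ × ℕ × ℕ → ℕ, Primrec P ∧ Primrec Q ∧ ∃ K : ℝ, ∀ l z e n : ℕ,
      a ≤ z / 2 ^ e →
      |(P (l, z, e, n) : ℝ) - Q (l, z, e, n) - 2 ^ n * haltingDeriv k l (z / 2 ^ e)| ≤ K := by
  induction k with
  | zero =>
    refine ⟨_, fun _ => 0, primrec_floorHaltingTerm, Primrec.const 0, 1, fun l z e n h => ?_⟩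
    have hz : z ≠ 0 := by
      rintro rfl
      simp at h
      linarith
    simpa using abs_floorHaltingTerm_sub_le l hz e n
  | succ k ih =>
    obtain ⟨P, Q, hP, hQ, K, hK⟩ := ih
    obtain ⟨M, hM0, hM⟩ := exists_abs_haltingDeriv_le_const (k + 2) ha
    have hl : Primrec fun t : ℕ × ℕ × ℕ × ℕ => t.1 := Primrec.fst
    have hz : Primrec fun t : ℕ × ℕ × ℕ × ℕ => t.2.1 := Primrec.fst.comp Primrec.snd
    have he : Primrec fun t : ℕ × ℕ × ℕ × ℕ => t.2.2.1 :=
      Primrec.fst.comp <| Primrec.snd.comp Primrec.snd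
    have hn : Primrec fun t : ℕ × ℕ × ℕ × ℕ => t.2.2.2 :=
      Primrec.snd.comp <| Primrec.snd.comp Primrec.snd
    have hzn := Primrec.nat_mul.comp hz (Primrec.two_pow.comp hn)
    have hen : Primrec fun t : ℕ × ℕ × ℕ × ℕ => (t.2.2.1 + t.2.2.2, 2 * t.2.2.2) :=
      (Primrec.nat_add.comp he hn).pair (Primrec.nat_mul.comp (Primrec.const 2) hn)
    have h1 : Primrec fun t : ℕ × ℕ × ℕ × ℕ =>
        (t.1, t.2.1 * 2 ^ t.2.2.2 + 2 ^ t.2.2.1, t.2.2.1 + t.2.2.2, 2 * t.2.2.2) :=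
      hl.pair ((Primrec.nat_add.comp hzn (Primrec.two_pow.comp he)).pair hen)
    have h2 : Primrec fun t : ℕ × ℕ × ℕ × ℕ =>
        (t.1, t.2.1 * 2 ^ t.2.2.2, t.2.2.1 + t.2.2.2, 2 * t.2.2.2) :=
      hl.pair (hzn.pair hen)
    -- Subtracting the value at `x` from that at `x + 2 ^ (-n)` exchanges the roles of `P` and `Q`
    -- at `x`. The errors are `K` at each endpoint and `M` from the difference quotient.
    refine ⟨_, _, Primrec.nat_add.comp (hP.comp h1) (hQ.comp h2),
      Primrec.nat_add.comp (hQ.comp h1) (hP.comp h2), K + K + M, fun l z e n h => ?_⟩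
    have hx1 : (((z * 2 ^ n + 2 ^ e : ℕ) : ℝ) / 2 ^ (e + n)) = z / 2 ^ e + 1 / 2 ^ n := by
      push_cast
      rw [pow_add]
      field_simp
    have hx2 : (((z * 2 ^ n : ℕ) : ℝ) / 2 ^ (e + n)) = z / 2 ^ e := by
      push_cast
      rw [pow_add]
      field_simp
    have hh : (0 : ℝ) < 1 / 2 ^ n := by positivity
    have e1 := hK l (z * 2 ^ n + 2 ^ e) (e + n) (2 * n) (by rw [hx1]; linarith)
    have e2 := hK l (z * 2 ^ n) (e + n) (2 * n) (by rw [hx2]; exact h)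
    have e3 := abs_haltingDeriv_add_sub_sub_le ha hM l h hh
    rw [hx1] at e1
    rw [hx2] at e2
    have e4 : |2 ^ (2 * n) * (haltingDeriv k l (z / 2 ^ e + 1 / 2 ^ n)
        - haltingDeriv k l (z / 2 ^ e)
        - 1 / 2 ^ n * haltingDeriv (k + 1) l (z / 2 ^ e))| ≤ M := by
      rw [abs_mul, abs_of_pos (by positivity : (0 : ℝ) < 2 ^ (2 * n))]
      refine (mul_le_mul_of_nonneg_left e3 (by positivity)).trans_eq ?_
      rw [two_mul, pow_add]
      field_simp
    have e5 : (2 : ℝ) ^ (2 * n) * (1 / 2 ^ n * haltingDeriv (k + 1) l (z / 2 ^ e))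
        = 2 ^ n * haltingDeriv (k + 1) l (z / 2 ^ e) := by
      rw [two_mul, pow_add]
      field_simp
    rw [mul_sub, e5] at e4
    push_cast
    rw [abs_le] at e1 e2 e4 ⊢
    constructor <;> nlinarith

theorem Computable.nat_add {α : Type*} [Primcodable α] {f g : α → ℕ} (hf : Computable f)
    (hg : Computable g) : Computable fun a => f a + g a :=
  Primrec.nat_add.to_comp.comp hf hg

theorem Computable.nat_mul {α : Type*} [Primcodable α] {f g : α → ℕ} (hf : Computable f)
    (hg : Computable g) : Computable fun a => f a * g a :=
  Primrec.nat_mul.to_comp.comp hf hg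

theorem Computable.two_pow {α : Type*} [Primcodable α] {f : α → ℕ} (hf : Computable f) :
    Computable fun a => 2 ^ f a :=
  Primrec.two_pow.to_comp.comp hf

theorem IsComputableReal.exists_computable_approx {x : ℝ} (hx : IsComputableReal x) :
    ∃ z : ℕ → ℕ, Computable z ∧ ∀ n, (z n : ℝ) / 2 ^ n ≤ Int.fract x ∧
      Int.fract x ≤ (z n + 1) / 2 ^ n := by
  obtain ⟨b, hb, hs⟩ := hx
  set z : ℕ → ℕ := fun n => n.rec 0 fun i y => 2 * y + (if b i then 1 else 0)
  refine ⟨z, ?_, fun n => ?_⟩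
  · refine Computable.nat_rec (h := fun _ t => 2 * t.2 + (if b t.1 then 1 else 0))
      Computable.id (Computable.const 0) ?_
    refine Computable.nat_add (Computable.nat_mul (Computable.const 2)
      (Computable.snd.comp Computable.snd)) ?_
    refine (Computable.cond (hb.comp (Computable.fst.comp Computable.snd))
      (Computable.const 1) (Computable.const 0)).of_eq fun t => ?_
    cases b t.2.1 <;> rfl
  set f : ℕ → ℝ := fun i => if b i then ((2 : ℝ) ^ (i + 1))⁻¹ else 0
  have hf0 (i : ℕ) : 0 ≤ f i := by simp only [f]; split <;> positivity
  have hfle (i : ℕ) : f i ≤ ((2 : ℝ) ^ (i + 1))⁻¹ := by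
    simp only [f]; split
    · exact le_rfl
    · positivity
  have hsum (n : ℕ) : ∑ i ∈ Finset.range n, f i = z n / 2 ^ n := by
    induction n with
    | zero => simp [z]
    | succ n ih =>
      rw [Finset.sum_range_succ, ih]
      have : z (n + 1) = 2 * z n + (if b n then 1 else 0) := rfl
      rw [this, pow_succ]
      simp only [f]
      split <;> push_cast <;> field_simp <;> ring
  constructor
  · rw [← hsum]
    exact sum_le_hasSum _ (fun i _ => hf0 i) hs
  · have h1 := (hasSum_nat_add_iff' n).2 hs
    rw [hsum] at h1
    have h2 : HasSum (fun i : ℕ => ((2 : ℝ) ^ (i + n + 1))⁻¹) (1 / 2 ^ n) := by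
      have := (hasSum_geometric_two).mul_left ((2 : ℝ) ^ (n + 1))⁻¹
      convert! this using 1
      · funext i
        rw [one_div, inv_pow, ← mul_inv, ← pow_add]
        congr 2
        ring
      · rw [pow_succ]; field_simp
    have := hasSum_le (fun i => hfle (i + n)) h1 h2
    rw [add_div]
    linarith

theorem exists_computable_approx_haltingDeriv (k : ℕ) {D : ℝ} (hD : D ∈ Ioo (0 : ℝ) 1)
    (hc : IsComputableReal D) :
    ∃ P Q : ℕ → ℕ → ℕ, Computable₂ P ∧ Computable₂ Q ∧ ∃ K : ℕ, ∀ l n : ℕ,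
      |(P l n : ℝ) - Q l n - 2 ^ n * haltingDeriv k l D| ≤ K := by
  obtain ⟨z, hz, hzD⟩ := hc.exists_computable_approx
  rw [Int.fract_eq_self.2 ⟨hD.1.le, hD.2⟩] at hzD
  obtain ⟨P, Q, hP, hQ, K, hK⟩ := exists_primrec_approx_haltingDeriv k hD.1
  obtain ⟨M, hM0, hM⟩ := exists_abs_haltingDeriv_le_const (k + 1) hD.1
  have harg : Computable fun t : ℕ × ℕ => (t.1, z t.2 + 1, t.2, t.2) :=
    Computable.fst.pair ((Computable.succ.comp (hz.comp Computable.snd)).pair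
      (Computable.snd.pair Computable.snd))
  -- Rounding `D` up keeps the argument in `[D, ∞)`, where the bounds are uniform; the shift of at
  -- most `2 ^ (-n)` costs `M`.
  refine ⟨fun l n => P (l, z n + 1, n, n), fun l n => Q (l, z n + 1, n, n),
    hP.to_comp.comp harg, hQ.to_comp.comp harg, ⌈K + M⌉₊, fun l n => ?_⟩
  refine le_trans ?_ (Nat.le_ceil _)
  have hle : D ≤ ((z n + 1 : ℕ) : ℝ) / 2 ^ n := by push_cast; exact (hzD n).2
  have h1 := hK l (z n + 1) n n hle
  have h2 := abs_haltingDeriv_sub_le hD.1 hM l le_rfl hle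
  have h3 : |2 ^ n * (haltingDeriv k l (((z n + 1 : ℕ) : ℝ) / 2 ^ n) - haltingDeriv k l D)|
      ≤ M := by
    rw [abs_mul, abs_of_pos (by positivity : (0 : ℝ) < 2 ^ n)]
    refine (mul_le_mul_of_nonneg_left h2 (by positivity)).trans ?_
    rw [abs_of_nonneg (sub_nonneg.2 hle), mul_left_comm]
    refine mul_le_of_le_one_right hM0 ?_
    have := (hzD n).1
    push_cast
    rw [add_div] at *
    rw [mul_sub, mul_add, mul_div_cancel₀ _ (by positivity), mul_div_cancel₀ _ (by positivity)]
    rw [div_le_iff₀' (by positivity)] at this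
    linarith
  rw [mul_sub] at h3
  rw [abs_le] at h1 h3 ⊢
  constructor <;> linarith

end Approximation

/-! ### Enumeration of the domain by halting stages. -/

section Halted

open Nat.Partrec

/-- The inputs on which the code `c` is seen to halt within `N` steps. -/
def halted (c : Code) (N : ℕ) : Finset ℕ :=
  (Finset.range N).filter fun i => (c.evaln N i).isSome

theorem mem_halted {c : Code} {N i : ℕ} : i ∈ halted c N ↔ ∃ x, x ∈ c.evaln N i := by
  rw [halted, Finset.mem_filter, Finset.mem_range, Option.isSome_iff_exists]
  exact ⟨fun h => h.2, fun h => ⟨Code.evaln_bound h.choose_spec, h⟩⟩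

theorem halted_mono (c : Code) : Monotone (halted c) := fun _ _ hN i hi => by
  obtain ⟨x, hx⟩ := mem_halted.1 hi
  exact mem_halted.2 ⟨x, Code.evaln_mono hN hx⟩

theorem dom_of_mem_halted {c : Code} {N i : ℕ} (h : i ∈ halted c N) : (c.eval i).Dom := by
  obtain ⟨x, hx⟩ := mem_halted.1 h
  exact Part.dom_iff_mem.2 ⟨x, Code.evaln_sound hx⟩

theorem eventually_mem_halted {c : Code} {i : ℕ} (h : (c.eval i).Dom) :
    ∀ᶠ N in atTop, i ∈ halted c N := by
  obtain ⟨x, hx⟩ := Part.dom_iff_mem.1 h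
  obtain ⟨N, hN⟩ := Code.evaln_complete.1 hx
  exact eventually_atTop.2 ⟨N, fun M hM => halted_mono c hM (mem_halted.2 ⟨x, hN⟩)⟩

/-- The family `g` restricted to the inputs on which `c` halts. -/
noncomputable def haltingIndicator (c : Code) (g : ℕ → ℝ) : ℕ → ℝ :=
  indicator {i | (c.eval i).Dom} g

theorem sum_halted_haltingIndicator (c : Code) (g : ℕ → ℝ) (N : ℕ) :
    ∑ i ∈ halted c N, haltingIndicator c g i = ∑ i ∈ halted c N, g i :=
  Finset.sum_congr rfl fun _ hi => indicator_of_mem (s := {i | (c.eval i).Dom})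
    (dom_of_mem_halted hi) g

theorem tendsto_sum_halted {c : Code} {g : ℕ → ℝ} {S : ℝ}
    (h : HasSum (haltingIndicator c g) S) :
    Tendsto (fun N => ∑ i ∈ halted c N, g i) atTop (nhds S) := by
  classical
  rw [HasSum, SummationFilter.unconditional_filter] at h
  refine tendsto_nhds.2 fun V hV hS => ?_
  obtain ⟨s, hs⟩ := mem_atTop_sets.1 (h (hV.mem_nhds hS))
  have hev : ∀ᶠ N in atTop, ∀ i ∈ s, (c.eval i).Dom → i ∈ halted c N := by
    rw [Filter.eventually_all_finset]
    intro i _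
    by_cases hi : (c.eval i).Dom
    · exact (eventually_mem_halted hi).mono fun _ h _ => h
    · exact Eventually.of_forall fun _ h => absurd h hi
  refine hev.mono fun N hN => ?_
  -- The stage need not contain `s`, but the inputs of `s` it misses never halt and contribute zero.
  have h1 := hs (halted c N ∪ s) Finset.subset_union_right
  rw [mem_preimage] at h1
  rwa [← Finset.sum_subset (Finset.subset_union_left (s₂ := s)), sum_halted_haltingIndicator] at h1
  intro i hi hiN
  refine indicator_of_notMem (s := {i | (c.eval i).Dom}) (fun hd => hiN (hN i ?_ hd)) g
  exact (Finset.mem_union.1 hi).resolve_left hiN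

theorem Computable.sum_range {α : Type*} [Primcodable α] {m : α → ℕ} {F : α → ℕ → ℕ}
    (hm : Computable m) (hF : Computable₂ F) :
    Computable fun a => ∑ i ∈ Finset.range (m a), F a i := by
  have h : Computable fun a => Nat.rec (motive := fun _ => ℕ) 0 (fun i y => y + F a i) (m a) :=
    Computable.nat_rec (h := fun a (t : ℕ × ℕ) => t.2 + F a t.1) hm (Computable.const 0)
      (Computable.nat_add (Computable.snd.comp Computable.snd)
        (hF.comp Computable.fst (Computable.fst.comp Computable.snd)))
  refine h.of_eq fun a => ?_
  induction m a with
  | zero => rfl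
  | succ n ih => rw [Finset.sum_range_succ, ← ih]

theorem computable_evaln {α : Type*} [Primcodable α] (c : Code) {m i : α → ℕ}
    (hm : Computable m) (hi : Computable i) : Computable fun a => c.evaln (m a) (i a) :=
  Code.primrec_evaln.to_comp.comp ((hm.pair (Computable.const c)).pair hi)

theorem computable_sum_halted {α : Type*} [Primcodable α] (c : Code) {m : α → ℕ}
    {F : α → ℕ → ℕ} (hm : Computable m) (hF : Computable₂ F) :
    Computable fun a => ∑ i ∈ halted c (m a), F a i := by
  have h : Computable₂ fun (a : α) (i : ℕ) => bif (c.evaln (m a) i).isSome then F a i else 0 :=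
    Computable.cond (Primrec.option_isSome.to_comp.comp
      (computable_evaln c (hm.comp Computable.fst) Computable.snd)) hF (Computable.const 0)
  refine (Computable.sum_range hm h).of_eq fun a => ?_
  rw [halted, Finset.sum_filter]
  refine Finset.sum_congr rfl fun i _ => ?_
  cases (c.evaln (m a) i).isSome <;> rfl

/-- The length of the program with code `i`. -/
def codeLength (i : ℕ) : ℕ := ((Encodable.decode i : Option (List Bool)).getD []).length

theorem codeLength_encode (p : List Bool) : codeLength (Encodable.encode p) = p.length := by
  simp [codeLength]

theorem computable_codeLength : Computable codeLength :=
  Computable.list_length.comp (Computable.option_getD Computable.decode (Computable.const []))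

/-- The code `c` computes `U` through the standard encodings. -/
def IsCodeOf (c : Code) (U : List Bool →. List Bool) : Prop :=
  c.eval = fun n => Part.bind (Encodable.decode₂ (List Bool) n : Part (List Bool))
    fun a => (U a).map Encodable.encode

variable {U : List Bool →. List Bool}

theorem exists_isCodeOf (hU : Partrec U) : ∃ c, IsCodeOf c U :=
  Code.exists_code.1 (Partrec.bind_decode₂_iff.1 hU)

theorem IsCodeOf.mem_eval {c : Code} (hc : IsCodeOf c U) {i x : ℕ} :
    x ∈ c.eval i ↔ ∃ p s, Encodable.encode p = i ∧ s ∈ U p ∧ Encodable.encode s = x := by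
  rw [hc]
  simp only [Part.mem_bind_iff, Part.mem_map_iff, Part.mem_ofOption, Option.mem_def,
    Encodable.decode₂_eq_some]
  constructor
  · rintro ⟨p, hp, s, hs, hx⟩; exact ⟨p, s, hp, hs, hx⟩
  · rintro ⟨p, s, hp, hs, hx⟩; exact ⟨p, hp, s, hs, hx⟩

theorem IsCodeOf.dom_eval {c : Code} (hc : IsCodeOf c U) {i : ℕ} :
    (c.eval i).Dom ↔ ∃ p ∈ U.Dom, Encodable.encode p = i := by
  rw [Part.dom_iff_mem]
  constructor
  · rintro ⟨x, hx⟩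
    obtain ⟨p, s, hp, hs, -⟩ := hc.mem_eval.1 hx
    exact ⟨p, Part.dom_iff_mem.2 ⟨s, hs⟩, hp⟩
  · rintro ⟨p, hp, hi⟩
    obtain ⟨s, hs⟩ := Part.dom_iff_mem.1 hp
    exact ⟨_, hc.mem_eval.2 ⟨p, s, hi, hs, rfl⟩⟩

theorem IsCodeOf.hasSum_iff {c : Code} (hc : IsCodeOf c U) (g : ℕ → ℝ) (S : ℝ) :
    HasSum (haltingIndicator c fun i => g (codeLength i)) S ↔
      HasSum (fun p : U.Dom => g (p : List Bool).length) S := by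
  have hinj : Function.Injective fun p : U.Dom => Encodable.encode (p : List Bool) :=
    Encodable.encode_injective.comp Subtype.val_injective
  rw [← hinj.hasSum_iff]
  · refine iff_of_eq (congrArg (HasSum · S) (funext fun p => ?_))
    rw [Function.comp_apply, haltingIndicator, indicator_of_mem, codeLength_encode]
    exact hc.dom_eval.2 ⟨p, p.2, rfl⟩
  · intro i hi
    refine indicator_of_notMem (fun hd => hi ?_) _
    obtain ⟨p, hp, rfl⟩ := hc.dom_eval.1 hd
    exact ⟨⟨p, hp⟩, rfl⟩

end Halted

/-! ### Binary words and expansions. -/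

section Bits

/-- The natural number with binary digits `w`, the most significant one first. -/
def bitsValue (w : List Bool) : ℕ := w.foldl (fun v b => 2 * v + b.toNat) 0

theorem bitsValue_concat (w : List Bool) (b : Bool) :
    bitsValue (w ++ [b]) = 2 * bitsValue w + b.toNat := by
  simp [bitsValue]

theorem bitsValue_append (u w : List Bool) :
    bitsValue (u ++ w) = 2 ^ w.length * bitsValue u + bitsValue w := by
  induction w using List.reverseRecOn with
  | nil => simp [bitsValue]
  | append_singleton w b ih =>
    rw [← List.append_assoc, bitsValue_concat, bitsValue_concat, ih, List.length_append,
      List.length_singleton, pow_succ]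
    ring

theorem bitsValue_lt (w : List Bool) : bitsValue w < 2 ^ w.length := by
  induction w using List.reverseRecOn with
  | nil => simp [bitsValue]
  | append_singleton w b ih =>
    rw [bitsValue_concat, List.length_append, List.length_singleton, pow_succ]
    have := Bool.toNat_lt b
    omega

theorem computable_bitsValue : Computable bitsValue := by
  refine Primrec.to_comp (Primrec.list_foldl (h := fun _ (t : ℕ × Bool) => 2 * t.1 + t.2.toNat) Primrec.id
    (Primrec.const 0) ?_)
  exact Primrec.nat_add.comp (Primrec.nat_mul.comp (Primrec.const 2)
    (Primrec.fst.comp Primrec.snd)) ((Primrec.dom_bool Bool.toNat).comp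
    (Primrec.snd.comp Primrec.snd))

/-- The last `n` binary digits of `v`, the most significant one first. -/
def natBits (n v : ℕ) : List Bool :=
  (List.range n).map fun i => decide (v / 2 ^ (n - 1 - i) % 2 = 1)

theorem computable_natBits : Computable₂ natBits := by
  refine Primrec.to_comp (Primrec.list_map (Primrec.list_range.comp Primrec.fst) ?_)
  have hn : Primrec fun t : (ℕ × ℕ) × ℕ => t.1.1 - 1 - t.2 :=
    Primrec.nat_sub.comp (Primrec.nat_sub.comp (Primrec.fst.comp Primrec.fst) (Primrec.const 1))
      Primrec.snd
  have h : PrimrecPred fun t : (ℕ × ℕ) × ℕ => t.1.2 / 2 ^ (t.1.1 - 1 - t.2) % 2 = 1 :=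
    Primrec.eq.comp (Primrec.nat_mod.comp (Primrec.nat_div.comp (Primrec.snd.comp Primrec.fst)
      (Primrec.two_pow.comp hn)) (Primrec.const 2)) (Primrec.const 1)
  exact h.decide

theorem length_natBits (n v : ℕ) : (natBits n v).length = n := by simp [natBits]

theorem bitsValue_natBits {n v : ℕ} (hv : v < 2 ^ n) : bitsValue (natBits n v) = v := by
  induction n generalizing v with
  | zero =>
    have : v = 0 := by simpa using hv
    simp [natBits, bitsValue, this]
  | succ n ih =>
    have h : natBits (n + 1) v = natBits n (v / 2) ++ [decide (v % 2 = 1)] := by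
      rw [natBits, List.range_succ, List.map_append, natBits]
      congr 1
      · refine List.map_congr_left fun i hi => ?_
        have hi := List.mem_range.1 hi
        rw [Nat.div_div_eq_div_mul, ← pow_succ', show n + 1 - 1 - i = n - 1 - i + 1 by omega]
      · simp
    rw [h, bitsValue_concat, ih (by rw [pow_succ] at hv; omega)]
    rcases Nat.mod_two_eq_zero_or_one v with h' | h' <;> simp [h'] <;> omega

theorem Int.floor_mul_two_pow_div (x : ℝ) (m j : ℕ) :
    ⌊x * 2 ^ (m + j)⌋ / 2 ^ j = ⌊x * 2 ^ m⌋ := by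
  have h : x * 2 ^ m = x * 2 ^ (m + j) / ((2 ^ j : ℕ) : ℝ) := by
    push_cast
    rw [pow_add]
    field_simp
  rw [h, Int.floor_div_natCast]
  push_cast
  rfl

theorem bitPrefix_succ (α : ℕ → Bool) (n : ℕ) : bitPrefix α (n + 1) = bitPrefix α n ++ [α n] := by
  simp [bitPrefix, List.range_succ]

theorem bitsValue_bitPrefix_binaryExpansion (x : ℝ) (n : ℕ) :
    (bitsValue (bitPrefix (binaryExpansion x) n) : ℤ) = ⌊Int.fract x * 2 ^ n⌋ := by
  induction n with
  | zero => simp [bitPrefix, bitsValue]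
  | succ n ih =>
    rw [bitPrefix_succ, bitsValue_concat]
    push_cast
    rw [ih, ← Int.floor_mul_two_pow_div _ n 1, binaryExpansion]
    rcases Int.emod_two_eq_zero_or_one ⌊Int.fract x * 2 ^ (n + 1)⌋ with h | h <;>
      simp [h] <;> omega

/-- Modulo `2 ^ n` the integer part of `x` disappears, so `x` may have any sign and size. -/
theorem natBits_eq_bitPrefix {x : ℝ} {n v : ℕ} (h : (v : ℤ) ≡ ⌊x * 2 ^ n⌋ [ZMOD 2 ^ n]) :
    natBits n v = bitPrefix (binaryExpansion x) n := by
  refine List.map_congr_left fun i hi => ?_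
  have hi := List.mem_range.1 hi
  obtain ⟨j, rfl⟩ : ∃ j, n = i + 1 + j := ⟨n - (i + 1), by omega⟩
  rw [binaryExpansion, show i + 1 + j - 1 - i = j by omega]
  have h1 : ⌊Int.fract x * 2 ^ (i + 1)⌋ = ⌊x * 2 ^ (i + 1)⌋ - 2 * (⌊x⌋ * 2 ^ i) := by
    rw [← Int.floor_sub_intCast, Int.fract]
    push_cast
    rw [pow_succ]
    congr 1
    ring
  obtain ⟨q, hq⟩ := h.symm.dvd
  have h2 : (v : ℤ) / 2 ^ j = ⌊x * 2 ^ (i + 1)⌋ + 2 * (2 ^ i * q) := by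
    have : (v : ℤ) = ⌊x * 2 ^ (i + 1 + j)⌋ + 2 ^ j * (2 * (2 ^ i * q)) := by
      have h3 : (2 : ℤ) ^ (i + 1 + j) = 2 ^ j * (2 * 2 ^ i) := by ring
      rw [h3] at hq
      linear_combination hq
    rw [this, Int.add_mul_ediv_left _ _ (by positivity), Int.floor_mul_two_pow_div]
  have h3 : ((v / 2 ^ j : ℕ) : ℤ) = (v : ℤ) / 2 ^ j := by push_cast; rfl
  rw [decide_eq_decide]
  omega

end Bits

/-! ### Bounds on program-size complexity. -/

section Complexity

variable {U : List Bool →. List Bool}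

theorem coe_toENNReal_coe_nat (n : ℕ) : (((n : ℕ∞) : ENNReal) : EReal) = ((n : ℝ) : EReal) := by
  rw [ENat.toENNReal_coe, ← ENNReal.ofReal_natCast, EReal.coe_ennreal_ofReal,
    max_eq_left (Nat.cast_nonneg n)]

theorem ecomplexity_le {p s : List Bool} (h : s ∈ U p) :
    ecomplexity U s ≤ ((p.length : ℝ) : EReal) := by
  have h1 : complexity U s ≤ (p.length : ℕ∞) := iInf₂_le p h
  have h2 : ((complexity U s : ENNReal) : EReal) ≤ (((p.length : ℕ∞) : ENNReal) : EReal) :=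
    EReal.coe_ennreal_le_coe_ennreal_iff.2 (ENat.toENNReal_le.2 h1)
  rw [ecomplexity]
  refine h2.trans_eq ?_
  exact coe_toENNReal_coe_nat _

theorem le_ecomplexity {s : List Bool} {r : ℝ} (h : ∀ p, s ∈ U p → r ≤ p.length) :
    (r : EReal) ≤ ecomplexity U s := by
  rw [ecomplexity]
  by_cases hT : complexity U s = ⊤
  · simp [hT]
  · obtain ⟨n, hn⟩ := ENat.ne_top_iff_exists.1 hT
    have : ∃ p, s ∈ U p ∧ p.length ≤ n := by
      by_contra! hcon
      have h1 : ((n + 1 : ℕ) : ℕ∞) ≤ complexity U s :=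
        le_iInf₂ fun p hp => Nat.cast_le.2 (hcon p hp)
      rw [← hn] at h1
      exact absurd (Nat.cast_le.1 h1) (by omega)
    obtain ⟨p, hp, hpn⟩ := this
    have h1 : r ≤ n := (h p hp).trans (by exact_mod_cast hpn)
    rw [← hn]
    refine (EReal.coe_le_coe_iff.2 h1).trans_eq ?_
    exact coe_toENNReal_coe_nat _

/-- The additive constant may depend on `ε`: half of `ε * n` absorbs it for large `n`. -/
theorem isCompressible_of_forall_pos {D : ℝ} {α : ℕ → Bool}
    (h : ∀ ε > 0, ∃ C : ℝ, ∀ n, ∃ p, bitPrefix α n ∈ U p ∧ (p.length : ℝ) ≤ (D + ε) * n + C) :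
    IsCompressible U D α := by
  have h' (ε : ℝ) (hε : 0 < ε) : ∃ C : ℝ, ∀ n : ℕ,
      ecomplexity U (bitPrefix α n) ≤ (((D + ε) * n + C : ℝ) : EReal) := by
    obtain ⟨C, hC⟩ := h ε hε
    refine ⟨C, fun n => ?_⟩
    obtain ⟨p, hp, hpC⟩ := hC n
    exact (ecomplexity_le hp).trans (EReal.coe_le_coe_iff.2 hpC)
  have hbot (n : ℕ) : ecomplexity U (bitPrefix α n) ≠ ⊥ := EReal.coe_ennreal_ne_bot _
  have htop (n : ℕ) : ecomplexity U (bitPrefix α n) ≠ ⊤ := by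
    obtain ⟨C, hC⟩ := h' 1 one_pos
    exact ne_top_of_le_ne_top (EReal.coe_ne_top _) (hC n)
  set H : ℕ → ℝ := fun n => (ecomplexity U (bitPrefix α n)).toReal
  have hH (n : ℕ) : ((H n : ℝ) : EReal) = ecomplexity U (bitPrefix α n) :=
    EReal.coe_toReal (htop n) (hbot n)
  refine ⟨fun n => max 0 (H n - D * n), ?_, fun n => ?_⟩
  · refine isLittleO_iff.2 fun ε hε => ?_
    obtain ⟨C, hC⟩ := h' (ε / 2) (half_pos hε)
    filter_upwards [tendsto_natCast_atTop_atTop.eventually_ge_atTop (C / (ε / 2))] with n hn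
    rw [div_le_iff₀ (half_pos hε)] at hn
    have h1 := hC n
    rw [← hH, EReal.coe_le_coe_iff] at h1
    rw [Real.norm_of_nonneg (le_max_left _ _), Real.norm_of_nonneg (Nat.cast_nonneg n)]
    exact max_le (by positivity) (by linarith)
  · rw [← hH, EReal.coe_le_coe_iff]
    linarith [le_max_right 0 (H n - D * n)]

end Complexity

/-! ### Weak Chaitin randomness. -/

section Randomness

open Nat.Partrec

/-- `P` and `Q` witness that the numbers `a l` are uniformly computable: `P l n - Q l n`
approximates `2 ^ n * a l` up to the error `K`. -/
structure IsApproximation (P Q : ℕ → ℕ → ℕ) (K : ℕ) (a : ℕ → ℝ) : Prop where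
  computable_left : Computable₂ P
  computable_right : Computable₂ Q
  abs_sub_le : ∀ l n : ℕ, |(P l n : ℝ) - Q l n - 2 ^ n * a l| ≤ K

/-- The approximation of `2 ^ (n + N) * ∑ i ∈ halted c N, a (codeLength i)` given by
approximations `P` of the numbers `a l`. -/
def haltedSum (c : Code) (P : ℕ → ℕ → ℕ) (N n : ℕ) : ℕ :=
  ∑ i ∈ halted c N, P (codeLength i) (n + N)

theorem computable_haltedSum (c : Code) {P : ℕ → ℕ → ℕ} (hP : Computable₂ P) :
    Computable₂ (haltedSum c P) :=
  computable_sum_halted c (α := ℕ × ℕ) (F := fun t i => P (codeLength i) (t.2 + t.1))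
    Computable.fst (hP.comp (computable_codeLength.comp Computable.snd)
      (Computable.nat_add (Computable.snd.comp Computable.fst)
        (Computable.fst.comp Computable.fst)))

/-- Stage `N` has at most `N ≤ 2 ^ N` terms, so `N` additional bits of precision keep the total
error at `K` after division by `2 ^ N`. -/
theorem IsApproximation.abs_haltedSum_sub_le {P Q : ℕ → ℕ → ℕ} {K : ℕ} {a : ℕ → ℝ}
    (h : IsApproximation P Q K a) (c : Code) (N n : ℕ) :
    |(haltedSum c P N n : ℝ) - haltedSum c Q N n
      - 2 ^ N * (2 ^ n * ∑ i ∈ halted c N, a (codeLength i))| ≤ 2 ^ N * K := by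
  have h1 : (haltedSum c P N n : ℝ) - haltedSum c Q N n
      - 2 ^ N * (2 ^ n * ∑ i ∈ halted c N, a (codeLength i))
      = ∑ i ∈ halted c N, ((P (codeLength i) (n + N) : ℝ) - Q (codeLength i) (n + N)
        - 2 ^ (n + N) * a (codeLength i)) := by
    rw [Finset.sum_sub_distrib, Finset.sum_sub_distrib, ← Finset.mul_sum, haltedSum, haltedSum,
      pow_add]
    push_cast
    ring
  rw [h1]
  refine (Finset.abs_sum_le_sum_abs _ _).trans
    ((Finset.sum_le_card_nsmul _ _ (K : ℝ) fun i _ => h.abs_sub_le _ _).trans ?_)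
  rw [nsmul_eq_mul]
  refine mul_le_mul_of_nonneg_right ?_ (Nat.cast_nonneg K)
  have h2 : (halted c N).card ≤ 2 ^ N :=
    ((Finset.card_filter_le _ _).trans_eq (Finset.card_range N)).trans Nat.lt_two_pow_self.le
  exact_mod_cast h2

theorem IsComputer.bind {U : List Bool →. List Bool} (hU : IsComputer U)
    {ψ : List Bool →. List Bool} (hψ : Partrec ψ) : IsComputer fun p => (U p).bind ψ where
  partrec := hU.partrec.bind (hψ.comp Computable.snd)
  prefixFree p hp q hq := hU.prefixFree p hp.1 q hq.1

theorem Computable.list_replicate {α β : Type*} [Primcodable α] [Primcodable β] {f : α → ℕ}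
    (hf : Computable f) (b : β) : Computable fun a => List.replicate (f a) b := by
  refine (Primrec.list_map (Primrec.list_range) (Primrec.const b).to₂).to_comp.comp hf |>.of_eq
    fun a => ?_
  simp [List.map_const']

variable {U : List Bool →. List Bool} {c : Code}

/-- A string longer than all outputs that `c` produces within `N` steps. -/
def freshOutput (c : Code) (N : ℕ) : List Bool :=
  List.replicate (∑ i ∈ halted c N, codeLength ((c.evaln N i).getD 0) + 1) false

theorem computable_freshOutput (c : Code) : Computable (freshOutput c) :=
  Computable.list_replicate (Computable.nat_add (computable_sum_halted c
    (F := fun N i => codeLength ((c.evaln N i).getD 0)) Computable.id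
    (computable_codeLength.comp (Computable.option_getD
      (computable_evaln c Computable.fst Computable.snd) (Computable.const 0))))
    (Computable.const 1)) false

theorem IsCodeOf.notMem_halted_of_freshOutput_mem (hc : IsCodeOf c U) {N : ℕ} {q : List Bool}
    (hq : freshOutput c N ∈ U q) : Encodable.encode q ∉ halted c N := by
  intro hmem
  obtain ⟨x, hx⟩ := mem_halted.1 hmem
  have h1 : x = Encodable.encode (freshOutput c N) :=
    Part.mem_unique (Code.evaln_sound hx) (hc.mem_eval.2 ⟨q, _, rfl, hq, rfl⟩)
  have h2 := Finset.single_le_sum (f := fun i => codeLength ((c.evaln N i).getD 0))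
    (fun _ _ => Nat.zero_le _) hmem
  rw [Option.mem_def] at hx
  simp only [hx, Option.getD_some, h1, codeLength_encode] at h2
  simp [freshOutput] at h2

theorem IsCodeOf.eventually_halted_of_codeLength_lt (hc : IsCodeOf c U) (l₀ : ℕ) :
    ∃ N₀, ∀ N, N₀ ≤ N → ∀ i, (c.eval i).Dom → codeLength i < l₀ → i ∈ halted c N := by
  have hfin := (List.finite_length_lt Bool l₀).image Encodable.encode
  have : ∀ᶠ N in atTop, ∀ i ∈ hfin.toFinset, (c.eval i).Dom → i ∈ halted c N := by
    rw [Filter.eventually_all_finset]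
    intro i _
    by_cases hi : (c.eval i).Dom
    · exact (eventually_mem_halted hi).mono fun _ h _ => h
    · exact Eventually.of_forall fun _ h => absurd h hi
  obtain ⟨N₀, h⟩ := eventually_atTop.1 this
  refine ⟨N₀, fun N hN i hi hl => h N hN i ?_ hi⟩
  obtain ⟨p, -, rfl⟩ := hc.dom_eval.1 hi
  rw [codeLength_encode] at hl
  exact hfin.mem_toFinset.2 ⟨p, hl, rfl⟩

theorem IsOptimalComputer.isWeaklyChaitinRandom (hU : IsOptimalComputer U) {D : ℝ} (hD : 0 < D)
    {P Q : ℕ → ℕ → ℕ} {K l₀ : ℕ} {a : ℕ → ℝ} (h : IsApproximation P Q K a)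
    (ha : ∀ l, l₀ ≤ l → (2 : ℝ) ^ (-(l : ℝ) / D) ≤ a l) {S : ℝ}
    (hS : HasSum (fun p : U.Dom => a (p : List Bool).length) S) :
    IsWeaklyChaitinRandom U D (binaryExpansion S) := by
  obtain ⟨c, hc⟩ := exists_isCodeOf hU.isComputer.partrec
  rw [← hc.hasSum_iff a] at hS
  obtain ⟨N₀, hN₀⟩ := hc.eventually_halted_of_codeLength_lt l₀
  set V₁ := ⌊S⌋.toNat
  set V₂ := (-⌊S⌋).toNat
  have hV : (V₁ : ℝ) - V₂ = ⌊S⌋ := by exact_mod_cast Int.toNat_sub_toNat_neg ⌊S⌋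
  -- The tolerance `K + 1` makes the search end: `K` for the approximation, `1` for a partial sum
  -- within `2 ^ (-n)` of `S`. The constants `V₁`, `V₂` supply the integer part of `S`, and stages
  -- start at `N₀` so that all halting programs shorter than `l₀` are already counted.
  set test : List Bool → ℕ → Bool := fun w M =>
    decide (haltedSum c Q (M + N₀) w.length + 2 ^ (M + N₀) * (2 ^ w.length * V₁ + bitsValue w)
      ≤ haltedSum c P (M + N₀) w.length + 2 ^ (M + N₀) * (2 ^ w.length * V₂ + (K + 1))) with htest
  have htestc : Computable₂ test := by
    have hN : Computable fun t : List Bool × ℕ => t.2 + N₀ :=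
      Computable.nat_add Computable.snd (Computable.const N₀)
    have hl : Computable fun t : List Bool × ℕ => t.1.length :=
      Computable.list_length.comp Computable.fst
    have hle : Computable₂ fun x y : ℕ => decide (x ≤ y) := Primrec.nat_le.decide.to_comp
    exact hle.comp
      (Computable.nat_add ((computable_haltedSum c h.computable_right).comp hN hl)
        (Computable.nat_mul (Computable.two_pow hN) (Computable.nat_add
          (Computable.nat_mul (Computable.two_pow hl) (Computable.const V₁))
          (computable_bitsValue.comp Computable.fst))))
      (Computable.nat_add ((computable_haltedSum c h.computable_left).comp hN hl)
        (Computable.nat_mul (Computable.two_pow hN) (Computable.nat_add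
          (Computable.nat_mul (Computable.two_pow hl) (Computable.const V₂))
          (Computable.const (K + 1)))))
  set ψ : List Bool →. List Bool := fun w =>
    (Nat.rfind fun M => Part.some (test w M)).map fun M => freshOutput c (M + N₀)
  have hψ : Partrec ψ :=
    (Partrec.rfind htestc.partrec₂).map ((computable_freshOutput c).comp
      (Computable.nat_add Computable.snd (Computable.const N₀)))
  obtain ⟨sim, hsim⟩ := hU.simulates _ (hU.isComputer.bind hψ)
  -- The gap `2 * K + 2` adds the tolerance `K + 1`, the approximation error `K` and the truncation
  -- `1` of the expansion.
  refine ⟨D * (2 * K + 2) + sim, fun n => le_ecomplexity fun p hp => ?_⟩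
  set w := bitPrefix (binaryExpansion S) n with hw
  have hwl : w.length = n := by simp [hw, bitPrefix]
  have hval : (2 : ℝ) ^ n * ⌊S⌋ + bitsValue w ≤ 2 ^ n * S ∧
      2 ^ n * S < 2 ^ n * ⌊S⌋ + bitsValue w + 1 := by
    have h1 : (bitsValue w : ℝ) = ⌊Int.fract S * 2 ^ n⌋ := by
      exact_mod_cast bitsValue_bitPrefix_binaryExpansion S n
    have h2 : Int.fract S * 2 ^ n = 2 ^ n * S - 2 ^ n * ⌊S⌋ := by rw [Int.fract]; ring
    have h3 := Int.floor_le (Int.fract S * 2 ^ n)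
    have h4 := Int.lt_floor_add_one (Int.fract S * 2 ^ n)
    rw [← h1, h2] at h3 h4
    constructor <;> linarith
  have htest_iff (M : ℕ) : test w M = true ↔
      (2 : ℝ) ^ (M + N₀) * (2 ^ n * ⌊S⌋ + bitsValue w - (K + 1))
        ≤ (haltedSum c P (M + N₀) n : ℝ) - haltedSum c Q (M + N₀) n := by
    rw [htest, decide_eq_true_eq, hwl, ← Nat.cast_le (α := ℝ), ← hV]
    push_cast
    constructor <;> intro h <;> linarith
  have hex : ∃ M, test w M = true := by
    have h1 : ∀ᶠ N in atTop, S - 1 / 2 ^ n < ∑ i ∈ halted c N, a (codeLength i) :=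
      (tendsto_sum_halted hS).eventually_const_lt (sub_lt_self _ (by positivity))
    obtain ⟨M, hM⟩ := eventually_atTop.1 h1
    refine ⟨M, (htest_iff M).2 ?_⟩
    have h2 := hM (M + N₀) (Nat.le_add_right _ _)
    have h3 := h.abs_haltedSum_sub_le c (M + N₀) n
    have h4 : (2 : ℝ) ^ n * S - 1 ≤ 2 ^ n * ∑ i ∈ halted c (M + N₀), a (codeLength i) := by
      have := mul_le_mul_of_nonneg_left h2.le (by positivity : (0 : ℝ) ≤ 2 ^ n)
      rwa [mul_sub, mul_one_div_cancel (by positivity)] at this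
    have h5 : (2 : ℝ) ^ (M + N₀) * (2 ^ n * ⌊S⌋ + bitsValue w - 1)
        ≤ 2 ^ (M + N₀) * (2 ^ n * ∑ i ∈ halted c (M + N₀), a (codeLength i)) :=
      mul_le_mul_of_nonneg_left (by linarith [hval.1]) (by positivity)
    rw [abs_le] at h3
    linarith [h3.1]
  obtain ⟨M₀, hM₀⟩ := hex
  obtain ⟨M, hM, -⟩ := Nat.rfind_min' hM₀
  have htM : test w M = true := (Part.mem_some_iff.1 (Nat.rfind_spec hM)).symm
  obtain ⟨q, hq, hql⟩ := hsim p (freshOutput c (M + N₀))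
    (Part.mem_bind hp (Part.mem_map _ hM))
  have hqn := hc.notMem_halted_of_freshOutput_mem hq
  have hqd : (c.eval (Encodable.encode q)).Dom :=
    hc.dom_eval.2 ⟨q, Part.dom_iff_mem.2 ⟨_, hq⟩, rfl⟩
  have hlong (i : ℕ) (hi : i ∉ halted c (M + N₀)) (hd : (c.eval i).Dom) :
      (2 : ℝ) ^ (-(codeLength i : ℝ) / D) ≤ a (codeLength i) :=
    ha _ (not_lt.1 fun hl => hi (hN₀ _ (Nat.le_add_left _ _) i hd hl))
  have htail : (2 : ℝ) ^ (-(q.length : ℝ) / D)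
      ≤ S - ∑ i ∈ halted c (M + N₀), a (codeLength i) := by
    -- Only the terms outside the finite set must be nonnegative; the possibly negative ones, of
    -- short programs, have already been summed.
    have h1 := sum_le_hasSum (insert (Encodable.encode q) (halted c (M + N₀))) (fun i hi => ?_) hS
    · rw [Finset.sum_insert hqn, sum_halted_haltingIndicator, haltingIndicator,
        indicator_of_mem (show Encodable.encode q ∈ {i | (c.eval i).Dom} from hqd)] at h1
      have h2 := hlong _ hqn hqd
      rw [codeLength_encode] at h1 h2
      linarith
    · refine indicator_apply_nonneg fun hd => ?_
      exact (by positivity : (0 : ℝ) ≤ 2 ^ (-(codeLength i : ℝ) / D)).trans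
        (hlong i (fun h => hi (Finset.mem_insert_of_mem h)) hd)
  have hupper : (2 : ℝ) ^ n * (S - ∑ i ∈ halted c (M + N₀), a (codeLength i))
      ≤ 2 * K + 2 := by
    have h1 := (htest_iff M).1 htM
    have h2 := (abs_le.1 (h.abs_haltedSum_sub_le c (M + N₀) n)).2
    have h3 : (2 : ℝ) ^ (M + N₀) * (2 ^ n * ⌊S⌋ + bitsValue w - (K + 1))
        ≤ 2 ^ (M + N₀) * (2 ^ n * ∑ i ∈ halted c (M + N₀), a (codeLength i) + K) := by
      rw [mul_add]
      linarith
    have h4 := le_of_mul_le_mul_left h3 (by positivity)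
    rw [mul_sub]
    linarith [hval.2]
  have hfinal : (n : ℝ) + -(q.length : ℝ) / D ≤ 2 * K + 2 := by
    have h1 : (2 : ℝ) ^ ((n : ℝ) + -(q.length : ℝ) / D) ≤ 2 ^ ((2 * K + 2 : ℕ) : ℝ) := by
      rw [Real.rpow_add two_pos, Real.rpow_natCast, Real.rpow_natCast]
      refine ((mul_le_mul_of_nonneg_left htail (by positivity)).trans hupper).trans ?_
      exact_mod_cast (Nat.lt_two_pow_self (n := 2 * K + 2)).le
    have h2 := (Real.rpow_le_rpow_left_iff one_lt_two).1 h1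
    exact_mod_cast h2
  have h6 : D * n - q.length ≤ D * (2 * K + 2) := by
    have := mul_le_mul_of_nonneg_left hfinal hD.le
    rw [mul_add, mul_div_cancel₀ _ hD.ne'] at this
    linarith
  have h7 : (q.length : ℝ) ≤ p.length + sim := by exact_mod_cast hql
  linarith

end Randomness

/-! ### Compressibility through the bits of the halting probability. -/

section Compressibility

open Nat.Partrec

/-- The number `t` of blocks announced by a program `1 ^ t 0 w`. -/
def blockCount (p : List Bool) : ℕ := p.findIdx (!·)

theorem computable_blockCount : Computable blockCount :=
  (Primrec.list_findIdx (p := fun _ b => !b) Primrec.id (Primrec.not.comp Primrec.snd)).to_comp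

theorem blockCount_append {p : List Bool} (h : blockCount p < p.length) (u : List Bool) :
    blockCount (p ++ u) = blockCount p := by
  rw [blockCount, List.findIdx_append, if_pos]
  · rfl
  · exact h

/-- The program made of the number `t`, in unary, and the payload `w`. -/
def blockProgram (t : ℕ) (w : List Bool) : List Bool := List.replicate t true ++ false :: w

theorem blockCount_blockProgram (t : ℕ) (w : List Bool) : blockCount (blockProgram t w) = t := by
  induction t with
  | zero => simp [blockCount, blockProgram, List.findIdx_cons]
  | succ t ih =>
    rw [blockProgram, List.replicate_succ, List.cons_append, blockCount, List.findIdx_cons]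
    exact congrArg (· + 1) ih

theorem length_blockProgram (t : ℕ) (w : List Bool) :
    (blockProgram t w).length = t + 1 + w.length := by
  simp [blockProgram]
  omega

theorem bitsValue_blockProgram_mod (t : ℕ) (w : List Bool) :
    bitsValue (blockProgram t w) % 2 ^ w.length = bitsValue w := by
  have h : blockProgram t w = (List.replicate t true ++ [false]) ++ w := by simp [blockProgram]
  rw [h, bitsValue_append, Nat.mul_add_mod, Nat.mod_eq_of_lt (bitsValue_lt w)]

/-- The stage `N` of the enumeration of the domain of `c` is late enough for the payload of the
program `p`, which consists of `A * t` bits of the halting probability. -/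
def stageTest (c : Code) (A : ℕ) (p : List Bool) (N : ℕ) : Bool :=
  decide (p.length = blockCount p + 1 + A * blockCount p ∧
    bitsValue p % 2 ^ (A * blockCount p) * 2 ^ N
      < ∑ i ∈ halted c N, 2 ^ (A * blockCount p + N - codeLength i))

theorem computable_stageTest (c : Code) (A : ℕ) : Computable₂ (stageTest c A) := by
  have hb : Computable fun t : List Bool × ℕ => A * blockCount t.1 :=
    Computable.nat_mul (Computable.const A) (computable_blockCount.comp Computable.fst)
  have hsum : Computable fun t : List Bool × ℕ =>
      ∑ i ∈ halted c t.2, 2 ^ (A * blockCount t.1 + t.2 - codeLength i) :=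
    computable_sum_halted c
      (F := fun (t : List Bool × ℕ) i => 2 ^ (A * blockCount t.1 + t.2 - codeLength i))
      Computable.snd (Computable.two_pow (Primrec.nat_sub.to_comp.comp
        (Computable.nat_add (hb.comp Computable.fst) (Computable.snd.comp Computable.fst))
        (computable_codeLength.comp Computable.snd)))
  have heq : Computable₂ fun x y : ℕ => decide (x = y) := Primrec.eq.decide.to_comp
  have hlt : Computable₂ fun x y : ℕ => decide (x < y) := Primrec.nat_lt.decide.to_comp
  have h1 := heq.comp (Computable.list_length.comp Computable.fst)
    (Computable.nat_add (Computable.nat_add (computable_blockCount.comp Computable.fst)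
      (Computable.const 1)) hb)
  have h2 := hlt.comp (Computable.nat_mul (Primrec.nat_mod.to_comp.comp
    (computable_bitsValue.comp Computable.fst) (Computable.two_pow hb))
      (Computable.two_pow Computable.snd)) hsum
  refine (Primrec.and.to_comp.comp h1 h2).of_eq fun t => ?_
  rw [stageTest, Bool.decide_and]

/-- The first `B * t + r` bits of the approximation, corrected by `e₁ - e₂`, of the fractional part
of the sum with approximations `P` and `Q` at the stage `N`. -/
def blockOutput (c : Code) (P Q : ℕ → ℕ → ℕ) (B r e₁ e₂ : ℕ) (p : List Bool) (N : ℕ) : List Bool :=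
  let n := B * blockCount p + r
  natBits n (haltedSum c P N n / 2 ^ N + e₁
    + (2 ^ n - 1) * (haltedSum c Q N n / 2 ^ N + e₂))

theorem computable_blockOutput (c : Code) {P Q : ℕ → ℕ → ℕ} (hP : Computable₂ P)
    (hQ : Computable₂ Q) (B r e₁ e₂ : ℕ) : Computable₂ (blockOutput c P Q B r e₁ e₂) := by
  have hn : Computable fun t : List Bool × ℕ => B * blockCount t.1 + r :=
    Computable.nat_add (Computable.nat_mul (Computable.const B)
      (computable_blockCount.comp Computable.fst)) (Computable.const r)
  have hdiv {P : ℕ → ℕ → ℕ} (hP : Computable₂ P) (e : ℕ) : Computable fun t : List Bool × ℕ =>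
      haltedSum c P t.2 (B * blockCount t.1 + r) / 2 ^ t.2 + e :=
    Computable.nat_add (Primrec.nat_div.to_comp.comp
      ((computable_haltedSum c hP).comp Computable.snd hn) (Computable.two_pow Computable.snd))
      (Computable.const e)
  exact computable_natBits.comp hn (Computable.nat_add (hdiv hP e₁) (Computable.nat_mul
    (Primrec.nat_sub.to_comp.comp (Computable.two_pow hn) (Computable.const 1)) (hdiv hQ e₂)))

/-- The computer that reads `t` and `A * t` bits of the halting probability, and outputs
`B * t + r` bits. -/
def blockComputer (c : Code) (P Q : ℕ → ℕ → ℕ) (A B r e₁ e₂ : ℕ) : List Bool →. List Bool :=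
  fun p => (Nat.rfind fun N => Part.some (stageTest c A p N)).map (blockOutput c P Q B r e₁ e₂ p)

theorem isComputer_blockComputer (c : Code) {P Q : ℕ → ℕ → ℕ} (hP : Computable₂ P)
    (hQ : Computable₂ Q) (A B r e₁ e₂ : ℕ) : IsComputer (blockComputer c P Q A B r e₁ e₂) where
  partrec := (Partrec.rfind (computable_stageTest c A).partrec₂).map
    (computable_blockOutput c hP hQ B r e₁ e₂)
  prefixFree p hp q hq hpq := by
    have hlen {p : List Bool} (hp : p ∈ (blockComputer c P Q A B r e₁ e₂).Dom) :
        p.length = blockCount p + 1 + A * blockCount p := by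
      obtain ⟨N, hN⟩ := Part.dom_iff_mem.1
        (show (Nat.rfind fun N => Part.some (stageTest c A p N)).Dom from hp)
      have := (Part.mem_some_iff.1 (Nat.rfind_spec hN)).symm
      rw [stageTest, decide_eq_true_eq] at this
      exact this.1
    have h1 := hlen hp
    have h2 := hlen hq
    obtain ⟨u, rfl⟩ := hpq
    -- The length condition forces a `false` after the initial `true`s, so an extension has the same
    -- block count and hence the same length.
    rw [blockCount_append (by omega)] at h2
    exact (List.prefix_append p u).eq_of_length (h1.trans h2.symm)

variable {U : List Bool →. List Bool} {c : Code}

/-- Ensures that the natural subtraction in `stageTest` is never truncated. -/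
theorem IsCodeOf.codeLength_le (hc : IsCodeOf c U) {N i : ℕ} (hi : i ∈ halted c N) :
    codeLength i ≤ N := by
  obtain ⟨p, -, rfl⟩ := hc.dom_eval.1 (dom_of_mem_halted hi)
  rw [codeLength_encode]
  exact (Encodable.length_le_encode p).trans
    (Finset.mem_range.1 (Finset.mem_filter.1 hi).1).le

theorem IsCodeOf.stageTest_iff (hc : IsCodeOf c U) {A t : ℕ} {w : List Bool}
    (hw : w.length = A * t) (N : ℕ) : stageTest c A (blockProgram t w) N = true ↔
      (bitsValue w : ℝ) < 2 ^ (A * t) * ∑ i ∈ halted c N, (1 / 2 : ℝ) ^ codeLength i := by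
  have hsum : ((∑ i ∈ halted c N, 2 ^ (A * t + N - codeLength i) : ℕ) : ℝ)
      = 2 ^ (A * t) * (∑ i ∈ halted c N, (1 / 2 : ℝ) ^ codeLength i) * 2 ^ N := by
    rw [Finset.mul_sum, Finset.sum_mul]
    push_cast
    refine Finset.sum_congr rfl fun i hi => ?_
    have := hc.codeLength_le hi
    rw [pow_sub₀ _ two_ne_zero (by omega), pow_add, one_div, inv_pow]
    ring
  have hm := bitsValue_blockProgram_mod t w
  rw [hw] at hm
  rw [stageTest, decide_eq_true_eq, blockCount_blockProgram, length_blockProgram, hw, hm,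
    ← Nat.cast_lt (α := ℝ), hsum]
  push_cast
  rw [mul_lt_mul_iff_left₀ (by positivity)]
  simp

/-- Each missing program weighs at most the whole tail `2 ^ (-m)`, so its length `l` is at least
`m`. Hence `2 ^ (-θ * l) ≤ 2 ^ (-(θ - 1) * m) * 2 ^ (-l)`, and summing the last factor gives another
`2 ^ (-m)`. -/
theorem abs_sub_sum_halted_le {a : ℕ → ℝ} {S Ω C θ : ℝ} {m N : ℕ} (hθ : 1 ≤ θ) (hC : 0 ≤ C)
    (ha : ∀ l : ℕ, |a l| ≤ C * (2 : ℝ) ^ (-(θ * l)))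
    (hS : HasSum (haltingIndicator c fun i => a (codeLength i)) S)
    (hΩ : HasSum (haltingIndicator c fun i => (1 / 2 : ℝ) ^ codeLength i) Ω)
    (hN : Ω - ∑ i ∈ halted c N, (1 / 2 : ℝ) ^ codeLength i ≤ (1 / 2) ^ m) :
    |S - ∑ i ∈ halted c N, a (codeLength i)| ≤ C * (2 : ℝ) ^ (-(θ * m)) := by
  set wt : ℕ → ℝ := haltingIndicator c fun i => (1 / 2 : ℝ) ^ codeLength i with hwt
  have hwt0 (i : ℕ) : 0 ≤ wt i := indicator_nonneg (fun _ _ => by positivity) i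
  have hpow (l : ℕ) : (1 / 2 : ℝ) ^ l = 2 ^ (-(l : ℝ)) := by
    rw [Real.rpow_neg two_pos.le, Real.rpow_natCast, one_div, inv_pow]
  have h1 : HasSum (fun i : {i // i ∉ halted c N} =>
      haltingIndicator c (fun i => a (codeLength i)) i)
      (S - ∑ i ∈ halted c N, a (codeLength i)) := by
    have := (Finset.hasSum_compl_iff (a := S - ∑ i ∈ halted c N, a (codeLength i))
      (f := haltingIndicator c fun i => a (codeLength i)) (halted c N)).2
    rw [sum_halted_haltingIndicator, sub_add_cancel] at this
    exact this hS
  have h2 : HasSum (fun i : {i // i ∉ halted c N} => wt i)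
      (Ω - ∑ i ∈ halted c N, (1 / 2 : ℝ) ^ codeLength i) := by
    have := (Finset.hasSum_compl_iff
      (a := Ω - ∑ i ∈ halted c N, (1 / 2 : ℝ) ^ codeLength i) (f := wt) (halted c N)).2
    rw [hwt, sum_halted_haltingIndicator, sub_add_cancel] at this
    exact this hΩ
  have h3 := h1.norm_le_of_bounded (h2.mul_left (C * (2 : ℝ) ^ (-((θ - 1) * m)))) fun i => ?_
  · refine (show |_| ≤ _ from h3).trans ((mul_le_mul_of_nonneg_left hN (by positivity)).trans_eq ?_)
    rw [hpow, mul_assoc, ← Real.rpow_add two_pos]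
    congr 2
    ring
  · by_cases hi : (c.eval i).Dom
    · have hi' : (i : ℕ) ∈ {i | (c.eval i).Dom} := hi
      have h4 := (h2.summable.le_tsum i fun j _ => hwt0 j).trans (h2.tsum_eq.trans_le hN)
      rw [hwt, haltingIndicator, indicator_of_mem hi', hpow, hpow,
        Real.rpow_le_rpow_left_iff one_lt_two, neg_le_neg_iff] at h4
      rw [hwt, haltingIndicator, haltingIndicator, indicator_of_mem hi', indicator_of_mem hi',
        mul_assoc]
      refine (show |_| ≤ _ from ha _).trans (mul_le_mul_of_nonneg_left ?_ hC)
      rw [hpow, ← Real.rpow_add two_pos]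
      refine Real.rpow_le_rpow_of_exponent_le one_le_two ?_
      nlinarith
    · have hi' : (i : ℕ) ∉ {i | (c.eval i).Dom} := hi
      rw [hwt, haltingIndicator, haltingIndicator, indicator_of_notMem hi',
        indicator_of_notMem hi']
      simp

/-- Ceiling minus one instead of the floor: the inequality `v < 2 ^ m * Ω` must be strict for some
finite stage to exceed `v`. -/
theorem exists_nat_lt_two_pow_mul_le {Ω : ℝ} (h0 : 0 < Ω) (h1 : Ω ≤ 1) (m : ℕ) :
    ∃ v : ℕ, v < 2 ^ m ∧ (v : ℝ) < 2 ^ m * Ω ∧ 2 ^ m * Ω ≤ v + 1 := by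
  have hpos : (0 : ℝ) < 2 ^ m * Ω := by positivity
  have hc : 0 < ⌈2 ^ m * Ω⌉₊ := Nat.ceil_pos.2 hpos
  obtain ⟨v, hv⟩ := Nat.exists_eq_succ_of_ne_zero hc.ne'
  have h2 : (v : ℝ) < 2 ^ m * Ω := Nat.lt_ceil.1 (by omega)
  refine ⟨v, ?_, h2, ?_⟩
  · have : (v : ℝ) < 2 ^ m := h2.trans_le (mul_le_of_le_one_right (by positivity) h1)
    exact_mod_cast this
  · have := Nat.le_ceil (2 ^ m * Ω)
    rw [hv] at this
    exact_mod_cast this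

theorem IsApproximation.abs_haltedSum_div_sub_le {P Q : ℕ → ℕ → ℕ} {K : ℕ} {a : ℕ → ℝ}
    (h : IsApproximation P Q K a) (c : Code) (N n : ℕ) :
    |((haltedSum c P N n / 2 ^ N : ℕ) : ℝ) - (haltedSum c Q N n / 2 ^ N : ℕ)
      - 2 ^ n * ∑ i ∈ halted c N, a (codeLength i)| ≤ K + 1 := by
  have hq : (0 : ℝ) < 2 ^ N := by positivity
  have hdiv (x : ℕ) : ((x / 2 ^ N : ℕ) : ℝ) ≤ x / 2 ^ N ∧
      (x : ℝ) / 2 ^ N ≤ ((x / 2 ^ N : ℕ) : ℝ) + 1 := by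
    constructor
    · exact_mod_cast Nat.cast_div_le (α := ℝ) (m := x) (n := 2 ^ N)
    · rw [div_le_iff₀ hq]
      exact_mod_cast (Nat.lt_div_mul_add (a := x) (b := 2 ^ N) (by positivity)).le.trans_eq
        (by ring)
  have h1 : |(haltedSum c P N n : ℝ) / 2 ^ N - haltedSum c Q N n / 2 ^ N
      - 2 ^ n * ∑ i ∈ halted c N, a (codeLength i)| ≤ K := by
    have := h.abs_haltedSum_sub_le c N n
    rw [← mul_le_mul_iff_right₀ hq]
    refine le_trans (le_of_eq ?_) this
    rw [← abs_of_pos hq, ← abs_mul, abs_of_pos hq]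
    congr 1
    field_simp
  have hP := hdiv (haltedSum c P N n)
  have hQ := hdiv (haltedSum c Q N n)
  rw [abs_le] at h1 ⊢
  constructor <;> linarith

/-- Multiplication by `2 ^ n - 1` is negation modulo `2 ^ n`, which performs the subtraction within
the naturals. -/
theorem add_mul_two_pow_sub_one_modEq (n X Y e₁ e₂ : ℕ) {m : ℤ}
    (h : (X : ℤ) + e₁ - (Y + e₂) = m) :
    ((X + e₁ + (2 ^ n - 1) * (Y + e₂) : ℕ) : ℤ) ≡ m [ZMOD 2 ^ n] := by
  rw [Int.modEq_comm, Int.modEq_iff_dvd]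
  refine ⟨Y + e₂, ?_⟩
  have : ((2 ^ n - 1 : ℕ) : ℤ) = 2 ^ n - 1 := by
    rw [Nat.cast_sub Nat.one_le_two_pow]; push_cast; rfl
  push_cast [this]
  rw [← h]
  ring

theorem IsCodeOf.exists_bitPrefix_mem_blockComputer (hc : IsCodeOf c U)
    {P Q : ℕ → ℕ → ℕ} {K : ℕ} {a : ℕ → ℝ} (h : IsApproximation P Q K a) {S Ω C θ : ℝ}
    (hθ : 1 ≤ θ) (hC : 0 ≤ C) (ha : ∀ l : ℕ, |a l| ≤ C * (2 : ℝ) ^ (-(θ * l)))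
    (hS : HasSum (haltingIndicator c fun i => a (codeLength i)) S)
    (hΩ : HasSum (haltingIndicator c fun i => (1 / 2 : ℝ) ^ codeLength i) Ω)
    (hΩ0 : 0 < Ω) (hΩ1 : Ω ≤ 1) {A B r E : ℕ} (hAB : (B : ℝ) ≤ θ * A)
    (hE : 2 ^ r * C + K + 2 ≤ E) (t : ℕ) :
    ∃ e₁ ≤ E, ∃ e₂ ≤ E, ∃ p, p.length = t + 1 + A * t ∧
      bitPrefix (binaryExpansion S) (B * t + r) ∈ blockComputer c P Q A B r e₁ e₂ p := by
  set n := B * t + r with hn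
  obtain ⟨v, hv, hvΩ, hΩv⟩ := exists_nat_lt_two_pow_mul_le hΩ0 hΩ1 (A * t)
  set w := natBits (A * t) v
  have hw : w.length = A * t := length_natBits _ _
  have hwv : bitsValue w = v := bitsValue_natBits hv
  have hex : ∃ N, stageTest c A (blockProgram t w) N = true := by
    have h1 : ∀ᶠ N in atTop, (v : ℝ) < 2 ^ (A * t) * ∑ i ∈ halted c N, (1 / 2 : ℝ) ^ codeLength i :=
      ((tendsto_sum_halted hΩ).const_mul _).eventually_const_lt hvΩ
    obtain ⟨N, hN⟩ := h1.exists
    exact ⟨N, (hc.stageTest_iff hw N).2 (hwv ▸ hN)⟩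
  obtain ⟨N₀, hN₀⟩ := hex
  obtain ⟨N, hN, -⟩ := Nat.rfind_min' hN₀
  have htN := (hc.stageTest_iff hw N).1 (Part.mem_some_iff.1 (Nat.rfind_spec hN)).symm
  rw [hwv] at htN
  have htail : Ω - ∑ i ∈ halted c N, (1 / 2 : ℝ) ^ codeLength i ≤ (1 / 2) ^ (A * t) := by
    rw [one_div_pow, le_div_iff₀' (by positivity), mul_sub]
    linarith
  have hS1 := abs_sub_sum_halted_le hθ hC ha hS hΩ htail
  have hS2 : |2 ^ n * S - 2 ^ n * ∑ i ∈ halted c N, a (codeLength i)| ≤ 2 ^ r * C := by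
    rw [← mul_sub, abs_mul, abs_of_pos (by positivity : (0 : ℝ) < 2 ^ n)]
    refine (mul_le_mul_of_nonneg_left hS1 (by positivity)).trans ?_
    rw [mul_left_comm, mul_comm _ C]
    refine mul_le_mul_of_nonneg_left ?_ hC
    rw [← Real.rpow_natCast, ← Real.rpow_natCast, ← Real.rpow_add two_pos]
    refine Real.rpow_le_rpow_of_exponent_le one_le_two ?_
    rw [hn]
    push_cast
    have := mul_le_mul_of_nonneg_right hAB (Nat.cast_nonneg (α := ℝ) t)
    linarith
  have hS3 := h.abs_haltedSum_div_sub_le c N n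
  set X := haltedSum c P N n / 2 ^ N with hX
  set Y := haltedSum c Q N n / 2 ^ N with hY
  -- The correction is bounded independently of `t`: `2 ^ r * C` from the tail, `K + 1` from the
  -- approximation and `1` from the floor. It is built into the computer, not into the program.
  set e : ℤ := ⌊S * 2 ^ n⌋ - (X - Y) with he
  have heE : |(e : ℝ)| ≤ E := by
    refine le_trans ?_ hE
    have h1 := Int.floor_le (S * 2 ^ n)
    have h2 := Int.lt_floor_add_one (S * 2 ^ n)
    rw [he]
    push_cast
    rw [abs_le] at hS2 hS3 ⊢
    constructor <;> linarith
  have heE' : |e| ≤ E := by exact_mod_cast heE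
  rw [abs_le] at heE'
  refine ⟨e.toNat, by omega, (-e).toNat, by omega, blockProgram t w, ?_, ?_⟩
  · rw [length_blockProgram, hw]
  · have hout : blockOutput c P Q B r e.toNat (-e).toNat (blockProgram t w) N
        = bitPrefix (binaryExpansion S) n := by
      rw [blockOutput, blockCount_blockProgram]
      exact natBits_eq_bitPrefix (add_mul_two_pow_sub_one_modEq n X Y _ _ (m := ⌊S * 2 ^ n⌋) (by omega))
    rw [← hout]
    exact Part.mem_map _ hN

theorem IsOptimalComputer.exists_mem (hU : IsOptimalComputer U) (s : List Bool) :
    ∃ p, s ∈ U p := by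
  have hC : IsComputer fun p : List Bool =>
      (Nat.rfind fun _ => Part.some (decide (p = []))).map fun _ => s := by
    refine ⟨(Partrec.rfind ?_).map (Computable.const s).to₂, fun p hp q hq _ => ?_⟩
    · have : Primrec₂ fun (p : List Bool) (_ : ℕ) => decide (p = []) :=
        (Primrec.eq.decide.comp Primrec.fst (Primrec.const []))
      exact this.to_comp.partrec₂
    · have hnil {p : List Bool} (hp : ((Nat.rfind fun _ => Part.some (decide (p = []))).map
          fun _ => s).Dom) : p = [] := by
        obtain ⟨N, hN⟩ := Part.dom_iff_mem.1
          (show (Nat.rfind fun _ => Part.some (decide (p = []))).Dom from hp)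
        simpa using Nat.rfind_spec hN
      rw [hnil hp, hnil hq]
  obtain ⟨sim, hsim⟩ := hU.simulates _ hC
  obtain ⟨N, hN, -⟩ := Nat.rfind_min' (p := fun _ => decide (([] : List Bool) = [])) (m := 0) rfl
  obtain ⟨q, hq, -⟩ := hsim [] s (Part.mem_map _ hN)
  exact ⟨q, hq⟩

/-- A block of `B` output bits costs `A` bits of `Ω` and one unary bit. With `θ = 1 / D'` for `D'`
slightly above `D` and `A = ⌈D' * B⌉`, the rounding and the unary bit cost at most `2 ≤ ε * B / 2`.
-/
theorem exists_block_sizes {D ε : ℝ} (hD : D ∈ Ioo (0 : ℝ) 1) (hε : 0 < ε) :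
    ∃ θ : ℝ, 1 ≤ θ ∧ θ < 1 / D ∧ ∃ A B : ℕ, 0 < B ∧ (B : ℝ) ≤ θ * A ∧
      (A : ℝ) + 1 ≤ (D + ε) * B := by
  set D' := D + min (ε / 2) ((1 - D) / 2)
  have hD1 : D < D' := lt_add_of_pos_right D (lt_min (half_pos hε) (by linarith [hD.2]))
  have hD2 : D' ≤ D + ε / 2 := by
    have := min_le_left (ε / 2) ((1 - D) / 2)
    simp only [D']; linarith
  have hD3 : D' ≤ 1 := by
    have := min_le_right (ε / 2) ((1 - D) / 2)
    simp only [D']; linarith [hD.2]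
  have hD0 : 0 < D' := hD.1.trans hD1
  set B := ⌈4 / ε⌉₊
  have hB : 4 / ε ≤ B := Nat.le_ceil _
  rw [div_le_iff₀ hε] at hB
  have hB0 : 0 < B := Nat.ceil_pos.2 (by positivity)
  refine ⟨1 / D', (one_le_div hD0).2 hD3, one_div_lt_one_div_of_lt hD.1 hD1,
    ⌈D' * B⌉₊, B, hB0, ?_, ?_⟩
  · rw [one_div_mul_eq_div, le_div_iff₀' hD0]
    exact Nat.le_ceil _
  · have h1 := Nat.ceil_lt_add_one (show 0 ≤ D' * B by positivity)
    have h2 := mul_le_mul_of_nonneg_right hD2 (Nat.cast_nonneg (α := ℝ) B)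
    linarith

theorem IsOptimalComputer.isCompressible (hU : IsOptimalComputer U) {D : ℝ}
    (hD : D ∈ Ioo (0 : ℝ) 1) {P Q : ℕ → ℕ → ℕ} {K : ℕ} {a : ℕ → ℝ}
    (h : IsApproximation P Q K a)
    (ha : ∀ θ < 1 / D, ∃ C : ℝ, 0 ≤ C ∧ ∀ l : ℕ, |a l| ≤ C * (2 : ℝ) ^ (-(θ * l))) {S : ℝ}
    (hS : HasSum (fun p : U.Dom => a (p : List Bool).length) S) :
    IsCompressible U D (binaryExpansion S) := by
  obtain ⟨c, hc⟩ := exists_isCodeOf hU.isComputer.partrec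
  rw [← hc.hasSum_iff a] at hS
  have hsum := hU.isComputer.summable_half_pow_length
  have hΩ := (hc.hasSum_iff (fun l => (1 / 2 : ℝ) ^ l) _).2 hsum.hasSum
  have hΩ0 : 0 < ∑' p : U.Dom, (1 / 2 : ℝ) ^ (p : List Bool).length := by
    obtain ⟨p, hp⟩ := hU.exists_mem []
    exact hsum.tsum_pos (fun _ => by positivity) ⟨p, Part.dom_iff_mem.2 ⟨_, hp⟩⟩ (by positivity)
  refine isCompressible_of_forall_pos fun ε hε => ?_
  obtain ⟨θ, hθ1, hθD, A, B, hB, hAB, hABε⟩ := exists_block_sizes hD hε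
  obtain ⟨C, hC, haC⟩ := ha θ hθD
  set E := ⌈2 ^ B * C + K + 2⌉₊
  choose sim hsim using fun x : ℕ × ℕ × ℕ => hU.simulates _
    (isComputer_blockComputer c h.computable_left h.computable_right A B x.1 x.2.1 x.2.2)
  set T := Finset.range B ×ˢ Finset.range (E + 1) ×ˢ Finset.range (E + 1)
  -- Only finitely many computers occur, indexed by the remainder modulo `B` and the two
  -- corrections, so one simulation constant serves all `n`.
  refine ⟨1 + (T.sup sim : ℕ), fun n => ?_⟩
  have hr : n % B < B := Nat.mod_lt n hB
  have hE : 2 ^ (n % B) * C + K + 2 ≤ E := by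
    refine le_trans ?_ (Nat.le_ceil _)
    have := mul_le_mul_of_nonneg_right
      (pow_le_pow_right₀ (one_le_two (α := ℝ)) hr.le) hC
    linarith
  obtain ⟨e₁, he₁, e₂, he₂, p, hp, hmem⟩ := hc.exists_bitPrefix_mem_blockComputer h hθ1 hC haC hS
    hΩ hΩ0 hU.isComputer.tsum_half_pow_length_le_one hAB hE (n / B)
  rw [Nat.div_add_mod] at hmem
  obtain ⟨q, hq, hql⟩ := hsim (n % B, e₁, e₂) p _ hmem
  refine ⟨q, hq, ?_⟩
  have hsup : sim (n % B, e₁, e₂) ≤ T.sup sim := by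
    refine Finset.le_sup (f := sim) ?_
    simp only [T, Finset.mem_product, Finset.mem_range]
    omega
  have h1 : (q.length : ℝ) ≤ ((A : ℝ) + 1) * (n / B : ℕ) + 1 + (T.sup sim : ℕ) := by
    have : q.length ≤ (A + 1) * (n / B) + 1 + T.sup sim := by
      rw [add_mul]
      omega
    exact_mod_cast this
  have h2 : (B : ℝ) * (n / B : ℕ) ≤ n := by exact_mod_cast Nat.mul_div_le n B
  have h3 := mul_le_mul_of_nonneg_right hABε (Nat.cast_nonneg (α := ℝ) (n / B))
  have h4 := mul_le_mul_of_nonneg_left h2 (show 0 ≤ D + ε by linarith [hD.1])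
  linarith

end Compressibility

theorem mainTheorem5 (U : List Bool →. List Bool) (hU : IsOptimalComputer U) :
    (∀ D ∈ Ioo (0 : ℝ) 1, Summable (fun p : U.Dom => haltingTerm p D)) ∧
    ContDiffOn ℝ ∞ (haltingProb U) (Ioo 0 1) ∧
    (∀ k : ℕ, 1 ≤ k → ∀ D ∈ Ioo (0 : ℝ) 1,
      HasSum (fun p : U.Dom => iteratedDerivWithin k (haltingTerm p) (Ioo 0 1) D)
        (iteratedDerivWithin k (haltingProb U) (Ioo 0 1) D)) ∧
    (∀ k : ℕ, 1 ≤ k → ∀ D ∈ Ioo (0 : ℝ) 1, IsComputableReal D →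
      IsWeaklyChaitinRandom U D
        (binaryExpansion (iteratedDerivWithin k (haltingProb U) (Ioo 0 1) D)) ∧
      IsCompressible U D
        (binaryExpansion (iteratedDerivWithin k (haltingProb U) (Ioo 0 1) D))) := by
  have hC := hU.isComputer
  have hsum (k : ℕ) {D : ℝ} (hD : D ∈ Ioo (0 : ℝ) 1) :
      HasSum (fun p : U.Dom => haltingDeriv k (p : List Bool).length D)
        (iteratedDerivWithin k (haltingProb U) (Ioo 0 1) D) := by
    rw [hC.iteratedDerivWithin_haltingProb k hD]
    exact (hC.summable_haltingDeriv k hD).hasSum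
  refine ⟨fun D hD => ?_, hC.contDiffOn_haltingProb, fun k _ D hD => ?_, fun k hk D hD hDc => ?_⟩
  · simp_rw [haltingTerm_eq_haltingDeriv]
    exact hC.summable_haltingDeriv 0 hD
  · simp_rw [iteratedDerivWithin_haltingTerm k _ hD]
    exact hsum k hD
  · obtain ⟨P, Q, hP, hQ, K, hK⟩ := exists_computable_approx_haltingDeriv k hD hDc
    have happ : IsApproximation P Q K fun l => haltingDeriv k l D := ⟨hP, hQ, hK⟩
    obtain ⟨l₀, hl₀⟩ := exists_rpow_le_haltingDeriv hk hD.1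
    refine ⟨hU.isWeaklyChaitinRandom hD.1 happ hl₀ (hsum k hD),
      hU.isCompressible hD happ (fun θ hθ => ?_) (hsum k hD)⟩
    -- With `δ = 1 - θ * D` the exponent `(1 - δ) * l / D` is exactly `θ * l`.
    obtain ⟨C, hC0, h⟩ := exists_abs_haltingDeriv_le k hD.1
      (show 0 < 1 - θ * D by rw [lt_div_iff₀ hD.1] at hθ; linarith)
    refine ⟨C, hC0, fun l => (h l D le_rfl).trans_eq ?_⟩
    congr 3
    field_simp [hD.1.ne']
    ring
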